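/- Let $N,K\ge 1$ and $T,E\ge 0$ be integers with $K\ge 2$ and $M:=\max(T,E)<N$, and let $\mathbb F_q$ be a finite field. All random variables are discrete, and $H$ and $I$ denote Shannon entropy and mutual information. A database consists of $K$ independent files $W_1,\dots,W_K$, each uniform on $\mathbb F_q^L$ for some $L\ge 1$, replicated at $N$ nodes. The index $\kappa$ of the desired file is uniform on $\{1,\dots,K\}$; the user has private randomness $\mathcal U$; the nodes share common randomness $S$, unavailable to the user. The variables $\kappa,\mathcal U,(W_1,\dots,W_K),S$ are independent. A scheme specifies these randomness laws together with queries $Q_n^{[k]}$, which are functions of $\mathcal U$ (for each node $n$ and file index $k$), variables $S_n$ that are functions of $S$, and answers $A_n^{[k]}$ that are functions of $Q_n^{[k]}$, $W_{[1:K]}$ and $S_n$ (a function depending on $n$ but not on $k$). Let $\mathcal Q=(Q_n^{[k]})_{n,k}$. The scheme is a T-ESPIR scheme if 1. (decodability) for each $k$, $W_k$ is determined with zero error by $A_{[1:N]}^{[k]}$ and $\mathcal Q$; 2. (user-privacy) $I(\kappa; Q_{\mathcal T}^{[\kappa]},A_{\mathcal T}^{[\kappa]},W_{[1:K]},S)=0$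 for every set $\mathcal T$ of $T$ nodes; 3. (database-privacy) $I(W_{\bar\kappa};A_{[1:N]}^{[\kappa]},\mathcal Q,\kappa)=0$, where $W_{\bar\kappa}=(W_1,\dots,W_{\kappa-1},W_{\kappa+1},\dots,W_K)$; 4. (security against the eavesdropper) $I(W_{[1:K]};Q_{\mathcal E}^{[k]},A_{\mathcal E}^{[k]})=0$ for every set $\mathcal E$ of at most $E$ nodes and every $k$. For $k\in\{1,\dots,K\}$ its rate is $R=H(W_k)/\sum_{n=1}^N H(A_n^{[k]})$ and its secrecy rate is $\rho=H(S)/H(W_k)$ (for $T\ge 1$ neither depends on $k$). For real $\rho\ge 0$, the capacity $C(\rho)$ is the supremum of $R$ over all file lengths $L\ge1$ and all T-ESPIR schemes with secrecy rate $\rho$ (and $0$ if there are none). Theorem. For every $k\in\{1,\dots,K\}$ and every real $\rho\ge 0$, $$C(\rho)=\begin{cases}1-\dfrac{\max(T,E)}{N}, & \text{if }\rho\ge \dfrac{\max(T,E)}{N-\max(T,E)},\\[2mm] 0,&\text{otherwise.}\end{cases}$$ -/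

import Mathlib

open scoped ENNReal NNReal

noncomputable section

namespace SPIR

/-- Shannon entropy (natural logarithm) of a discrete distribution, with values in `[0, ∞]`. -/
def entropy {α : Type*} (p : PMF α) : ℝ≥0∞ :=
  ∑' x, ENNReal.ofReal (Real.negMulLog (p x).toReal)

/-- The law of a pair of independent variables with laws `p` and `q`. -/
def indepPair {α β : Type*} (p : PMF α) (q : PMF β) : PMF (α × β) :=
  p.bind fun a => q.map fun b => (a, b)

/-- Kullback-Leibler divergence of discrete distributions (all sets are measurable). -/
def relEntropy {α : Type*} (p q : PMF α) : ℝ≥0∞ :=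
  @InformationTheory.klDiv α ⊤ (@PMF.toMeasure α ⊤ p) (@PMF.toMeasure α ⊤ q)

/-- `I(X; Y)`: the divergence of the joint law of `(X, Y)` from the product of its marginals. -/
def mutualInfo {Ω α β : Type*} (p : PMF Ω) (X : Ω → α) (Y : Ω → β) : ℝ≥0∞ :=
  relEntropy (p.map fun ω => (X ω, Y ω)) (indepPair (p.map X) (p.map Y))

/-- The tuple `(w_1, …, w_{k-1}, w_{k+1}, …, w_K)`. -/
def others {K : ℕ} {β : Type*} (k : Fin K) (w : Fin K → β) : Fin (K - 1) → β :=
  fun i => if i.val < k.val then w ⟨i.val, by omega⟩ else w ⟨i.val + 1, by omega⟩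

/-- A file: `L` symbols of `F`. -/
abbrev File (F : Type*) (L : ℕ) := Fin L → F

/-- A database of `K` files. -/
abbrev Database (F : Type*) (K L : ℕ) := Fin K → File F L

/-- A retrieval protocol for a database of `K` files of `L` symbols of `F`, replicated at `N` nodes.
All random variables are discrete. -/
structure Protocol (F : Type*) (N K L : ℕ) where
  /-- alphabet of the private randomness of the user -/
  UserRand : Type
  /-- law of the private randomness of the user -/
  userLaw : PMF UserRand
  /-- alphabet of the common randomness `S` of the nodes -/
  CommonRand : Type
  /-- law of `S` -/
  commonLaw : PMF CommonRand
  /-- alphabet of `S_n` -/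
  NodeRand : Fin N → Type
  /-- `S_n` as a function of `S` -/
  nodeRand : ∀ n, CommonRand → NodeRand n
  /-- alphabet of the queries to node `n` -/
  Query : Fin N → Type
  /-- the query to node `n` when file `k` is desired -/
  query : ∀ n, Fin K → UserRand → Query n
  /-- alphabet of the answers of node `n` -/
  Answer : Fin N → Type
  /-- the answer of node `n`, from the query it received, the database and `S_n` -/
  answer : ∀ n, Query n → Database F K L → NodeRand n → Answer n

namespace Protocol

variable {F : Type*} {N K L : ℕ}

/-- Sample space: desired index, user randomness, database, common randomness. -/
abbrev Outcome (P : Protocol F N K L) := Fin K × P.UserRand × Database F K L × P.CommonRand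

variable (P : Protocol F N K L)

/-- The desired index `κ`. -/
def kappa (ω : P.Outcome) : Fin K := ω.1

/-- The user randomness `U`. -/
def user (ω : P.Outcome) : P.UserRand := ω.2.1

/-- The database `W_{[1:K]}`. -/
def files (ω : P.Outcome) : Database F K L := ω.2.2.1

/-- The common randomness `S`. -/
def common (ω : P.Outcome) : P.CommonRand := ω.2.2.2

/-- The query `Q_n^{[k]}`. -/
def Q (k : Fin K) (n : Fin N) (ω : P.Outcome) : P.Query n := P.query n k (P.user ω)

/-- The answer `A_n^{[k]}`. -/
def A (k : Fin K) (n : Fin N) (ω : P.Outcome) : P.Answer n :=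
  P.answer n (P.Q k n ω) (P.files ω) (P.nodeRand n (P.common ω))

/-- The queries `Q_I^{[k]}` received by the nodes in `I`. -/
def QOn (I : Finset (Fin N)) (k : Fin K) (ω : P.Outcome) : ∀ n : I, P.Query n :=
  fun n => P.Q k n ω

/-- The answers `A_I^{[k]}` of the nodes in `I`. -/
def AOn (I : Finset (Fin N)) (k : Fin K) (ω : P.Outcome) : ∀ n : I, P.Answer n :=
  fun n => P.A k n ω

/-- All answers `A_{[1:N]}^{[k]}`. -/
def allA (k : Fin K) (ω : P.Outcome) : ∀ n, P.Answer n := fun n => P.A k n ω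

/-- The complete query scheme: all queries, for all possible desired indices. -/
def queryScheme (ω : P.Outcome) : Fin K → ∀ n, P.Query n := fun k n => P.Q k n ω

variable [Fintype F] [Nonempty F] [NeZero K]

/-- The joint law: `κ` and the database are uniform, and `κ`, `U`, the database and `S` are
independent. -/
def law : PMF P.Outcome :=
  indepPair (PMF.uniformOfFintype (Fin K))
    (indepPair P.userLaw
      (indepPair (PMF.uniformOfFintype (Database F K L)) P.commonLaw))

/-- Zero-error decoding of the desired file from all answers and the query scheme. -/
def Decodable : Prop :=
  ∀ k : Fin K, ∃ dec : (Fin K → ∀ n, P.Query n) → (∀ n, P.Answer n) → File F L,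
    ∀ ω ∈ P.law.support, dec (P.queryScheme ω) (P.allA k ω) = P.files ω k

/-- User-privacy against any `T` colluding nodes. -/
def UserPrivate (T : ℕ) : Prop :=
  ∀ I : Finset (Fin N), I.card = T →
    mutualInfo P.law P.kappa
      (fun ω => (P.QOn I (P.kappa ω) ω, P.AOn I (P.kappa ω) ω, P.files ω, P.common ω)) = 0

/-- Database-privacy: the user learns nothing about the files that were not requested. -/
def DatabasePrivate : Prop :=
  mutualInfo P.law (fun ω => others (P.kappa ω) (P.files ω))
    (fun ω => (P.allA (P.kappa ω) ω, P.queryScheme ω, P.kappa ω)) = 0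

/-- An eavesdropper on any at most `E` nodes learns nothing about the database. -/
def EavesdropperSecure (E : ℕ) : Prop :=
  ∀ I : Finset (Fin N), I.card ≤ E → ∀ k : Fin K,
    mutualInfo P.law P.files (fun ω => (P.QOn I k ω, P.AOn I k ω)) = 0

/-- A scheme for SPIR with `T` colluding nodes and an eavesdropper on `E` nodes. -/
structure IsTESPIR (T E : ℕ) : Prop where
  decodable : P.Decodable
  userPrivate : P.UserPrivate T
  databasePrivate : P.DatabasePrivate
  eavesdropperSecure : P.EavesdropperSecure E

/-- `H(W_k)`. -/
def fileEntropy (k : Fin K) : ℝ≥0∞ := entropy (P.law.map fun ω => P.files ω k)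

/-- The rate `H(W_k) / ∑ n, H(A_n^{[k]})`. -/
def rate (k : Fin K) : ℝ≥0∞ := P.fileEntropy k / ∑ n, entropy (P.law.map (P.A k n))

/-- The secrecy rate `H(S) / H(W_k)`. -/
def secrecyRate (k : Fin K) : ℝ≥0∞ := entropy (P.law.map P.common) / P.fileEntropy k

end Protocol

/-- The supremum of the rates `H(W_k) / ∑ n, H(A_n^{[k]})` of the T-ESPIR schemes with secrecy rate
`ρ`, over all file lengths `L ≥ 1` (it is `0` if there are no such schemes). -/
def capacityTESPIR (F : Type*) [Fintype F] [Nonempty F] (N K T E : ℕ) [NeZero K] (ρ : ℝ≥0∞)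
    (k : Fin K) : ℝ≥0∞ :=
  ⨆ (L : ℕ) (_ : 1 ≤ L) (P : Protocol F N K L) (_ : P.IsTESPIR T E) (_ : P.secrecyRate k = ρ),
    P.rate k

end SPIR

end

/-! Write M = max(T, E).

Converse. Fix the user randomness `u` in its support, so that the answers A are functions of the
database and S. Database-privacy makes A jointly independent of the unrequested files. Any M answers
are independent of the requested file W_k: if M = E this is security; if M = T, user-privacy
supplies a `u'` which sends the same T queries while requesting another file, and database-privacy
then hides W_k (`IsTESPIR.indep_file_answers`). So the answers are shares of W_k, and H(W_k) +
H(A_I) ≤ H(A) whenever |I| = M. Han's inequality gives an I with H(A_I) ≥ (M/N) H(A), hence N H(W_k)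
≤ (N - M) H(A). As A is independent of the other files but determined by them, W_k and S, also H(A)
≤ H(W_k) + H(S), hence M H(W_k) ≤ (N - M) H(S) (`entropy_bounds_of_secret_sharing`). The second
bound is the threshold on ρ; the first, averaged over `u` by concavity of entropy, bounds the rate.

Achievability. Take a file to be N - M symbols of a field G with at least N elements. In
`polyScheme` the answers are the values at N points of a polynomial of degree less than N: its top N
- M coefficients are the desired file, and its low M coefficients are masked uniformly by S.
Interpolation decodes, the masked coefficients tell nothing about the other files, and M values of a
uniform polynomial of degree less than M are uniform, which hides the desired index in the queries
and the database in the answers. Unused noise in S raises the secrecy rate to exactly ρ. -/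

noncomputable section

namespace SPIR

/-! ### Independence of discrete variables and conditioning on a parameter -/

section Discrete

variable {Ω α β γ δ : Type*}

theorem indepPair_apply (p : PMF α) (q : PMF β) (x : α × β) :
    indepPair p q x = p x.1 * q x.2 := by
  classical
  simp only [indepPair, PMF.bind_apply, PMF.map_apply]
  rw [tsum_eq_single x.1]
  · congr 1
    rw [tsum_eq_single x.2]
    · simp
    · intro b hb
      rw [if_neg]
      rintro h
      exact hb (by rw [h])
  · intro a ha
    refine mul_eq_zero_of_right _ (ENNReal.tsum_eq_zero.2 fun b => if_neg fun h => ha ?_)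
    rw [h]

theorem mem_support_indepPair (p : PMF α) (q : PMF β) (x : α × β) :
    x ∈ (indepPair p q).support ↔ x.1 ∈ p.support ∧ x.2 ∈ q.support := by
  simp [PMF.mem_support_iff, indepPair_apply]

theorem map_fst_indepPair (p : PMF α) (q : PMF β) : (indepPair p q).map Prod.fst = p := by
  simp only [indepPair, PMF.map_bind, PMF.map_comp]
  have : ∀ a : α, (Prod.fst ∘ fun b : β => (a, b)) = Function.const β a := fun a => rfl
  simp [this, PMF.map_const]

theorem map_snd_indepPair (p : PMF α) (q : PMF β) : (indepPair p q).map Prod.snd = q := by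
  simp only [indepPair, PMF.map_bind, PMF.map_comp]
  have : ∀ a : α, (Prod.snd ∘ fun b : β => (a, b)) = id := fun a => rfl
  simp [this, PMF.map_id]

theorem map_prodMap_indepPair (p : PMF α) (q : PMF β) (f : α → γ) (g : β → δ) :
    (indepPair p q).map (Prod.map f g) = indepPair (p.map f) (q.map g) := by
  simp only [indepPair, PMF.map_bind, PMF.map_comp, PMF.bind_map]
  rfl

theorem indepPair_bind (p : PMF α) (q : PMF β) (f : α × β → PMF γ) :
    (indepPair p q).bind f = p.bind fun a => q.bind fun b => f (a, b) := by
  simp only [indepPair, PMF.bind_bind, PMF.bind_map]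
  rfl

theorem map_indepPair (p : PMF α) (q : PMF β) (f : α × β → γ) :
    (indepPair p q).map f = p.bind fun a => q.map fun b => f (a, b) := by
  simp only [indepPair, PMF.map_bind, PMF.map_comp]
  rfl

/-- Divergence vanishes only between equal measures, so every privacy condition becomes an identity
of laws. -/
theorem mutualInfo_eq_zero_iff (p : PMF Ω) (X : Ω → α) (Y : Ω → β) :
    mutualInfo p X Y = 0 ↔
      p.map (fun ω => (X ω, Y ω)) = indepPair (p.map X) (p.map Y) := by
  unfold mutualInfo relEntropy
  let _ : MeasurableSpace (α × β) := ⊤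
  have : MeasurableSingletonClass (α × β) := ⟨fun _ => trivial⟩
  rw [InformationTheory.klDiv_eq_zero_iff]
  exact PMF.toMeasure_injective.eq_iff

theorem map_pair_eq_of_eq_indepPair {p : PMF Ω} {X : Ω → α} {Y : Ω → β} {a : PMF α} {b : PMF β}
    (h : p.map (fun ω => (X ω, Y ω)) = indepPair a b) : p.map X = a ∧ p.map Y = b := by
  constructor
  · rw [← map_fst_indepPair a b, ← h, PMF.map_comp]; rfl
  · rw [← map_snd_indepPair a b, ← h, PMF.map_comp]; rfl

theorem mutualInfo_eq_zero_of_eq_indepPair {p : PMF Ω} {X : Ω → α} {Y : Ω → β} {a : PMF α}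
    {b : PMF β} (h : p.map (fun ω => (X ω, Y ω)) = indepPair a b) : mutualInfo p X Y = 0 := by
  rw [mutualInfo_eq_zero_iff, h, (map_pair_eq_of_eq_indepPair h).1,
    (map_pair_eq_of_eq_indepPair h).2]

/-- Independence of two discrete random variables. -/
def Indep (p : PMF Ω) (X : Ω → α) (Y : Ω → β) : Prop :=
  p.map (fun ω => (X ω, Y ω)) = indepPair (p.map X) (p.map Y)

theorem Indep.comp {p : PMF Ω} {X : Ω → α} {Y : Ω → β} (h : Indep p X Y) (f : α → γ)
    (g : β → δ) : Indep p (fun ω => f (X ω)) (fun ω => g (Y ω)) := by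
  have := congrArg (PMF.map (Prod.map f g)) h
  rw [map_prodMap_indepPair, PMF.map_comp, PMF.map_comp, PMF.map_comp] at this
  exact this

theorem map_apply_eq_tsum (p : PMF Ω) (X : Ω → α) (L : α → ℝ≥0∞) :
    ∑' x, p.map X x * L x = ∑' ω, p ω * L (X ω) := by
  classical
  simp only [PMF.map_apply, ← ENNReal.tsum_mul_right]
  rw [ENNReal.tsum_comm]
  refine tsum_congr fun ω => ?_
  rw [tsum_eq_single (X ω)]
  · simp
  · intro x hx; simp [hx]

/-- A discrete kernel applied to a parameter `c` through `g c`: joint law of the outcome with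
`g c`. -/
theorem map_fiber_apply (π : PMF α) (μ : PMF β) (g : α → γ) (Z : γ → β → δ) (z : δ) (c : γ) :
    (indepPair π μ).map (fun x => (Z (g x.1) x.2, g x.1)) (z, c) =
      π.map g c * μ.map (Z c) z := by
  classical
  have h : (indepPair π μ).map (fun x => (Z (g x.1) x.2, g x.1)) =
      (indepPair (π.map g) μ).map (fun x => (Z x.1 x.2, x.1)) := by
    simp only [map_indepPair, PMF.bind_map]
    rfl
  rw [h, map_indepPair, PMF.bind_apply, tsum_eq_single c]
  · congr 1
    rw [PMF.map_apply, PMF.map_apply]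
    simp
  · intro b hb
    rw [PMF.map_apply (fun y => (Z b y, b))]
    exact mul_eq_zero_of_right _ (ENNReal.tsum_eq_zero.2 fun a => if_neg fun h =>
      hb (Prod.ext_iff.1 h).2.symm)

/-- If `X` is independent of `(Y, g)`, it is independent of `Y` for every fixed value of `g`. -/
theorem Indep.fiber {π : PMF α} {μ : PMF β} {g : α → γ} {ε : Type*} {X : γ → β → δ}
    {Y : γ → β → ε}
    (h : Indep (indepPair π μ) (fun x => X (g x.1) x.2) (fun x => (Y (g x.1) x.2, g x.1)))
    {c : γ} (hc : c ∈ (π.map g).support) : Indep μ (X c) (Y c) := by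
  have hc0 : π.map g c ≠ 0 := (PMF.mem_support_iff _ _).1 hc
  have hct : π.map g c ≠ ∞ := PMF.apply_ne_top _ _
  set a := (indepPair π μ).map (fun x => X (g x.1) x.2) with ha
  have key : μ.map (fun ω => (X c ω, Y c ω)) = indepPair a (μ.map (Y c)) := by
    ext ⟨x, y⟩
    have h1 := congrArg (PMF.map (fun t : δ × (ε × γ) => ((t.1, t.2.1), t.2.2))) h
    rw [PMF.map_comp] at h1
    have h2 := DFunLike.congr_fun h1 ((x, y), c)
    have h3 := map_fiber_apply π μ g (fun c b => (X c b, Y c b)) (x, y) c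
    have h4 := map_fiber_apply π μ g Y y c
    have h5 : ∀ q : PMF (δ × (ε × γ)),
        q.map (fun t : δ × (ε × γ) => ((t.1, t.2.1), t.2.2)) ((x, y), c) = q (x, (y, c)) := by
      classical
      intro q
      rw [PMF.map_apply, tsum_eq_single (x, (y, c))]
      · simp
      · rintro ⟨x', y', c'⟩ hne
        rw [if_neg]
        intro h; apply hne
        simp only [Prod.mk.injEq] at h ⊢
        tauto
    rw [h5, indepPair_apply] at h2
    simp only [← ha] at h2
    rw [h4] at h2
    have h6 : π.map g c * μ.map (fun ω => (X c ω, Y c ω)) (x, y) =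
        π.map g c * (a x * μ.map (Y c) y) := by
      rw [← h3]
      refine Eq.trans h2 ?_
      ring
    rw [indepPair_apply]
    -- Conditioning on `g = c` amounts to cancelling its positive mass.
    exact (ENNReal.mul_right_inj hc0 hct).1 h6
  have := (map_pair_eq_of_eq_indepPair key).1
  unfold Indep
  rw [key, this]

end Discrete

/-! ### Shannon entropy with values in `[0, ∞]` -/

section Entropy

variable {Ω α β γ δ : Type*}

/-- The self-information of an outcome of probability `t`. -/
def info (t : ℝ≥0∞) : ℝ≥0∞ := ENNReal.ofReal (-Real.log t.toReal)

theorem info_anti {s t : ℝ≥0∞} (hs : s ≠ 0) (hst : s ≤ t) (ht : t ≤ 1) : info t ≤ info s := by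
  have ht' : t ≠ ∞ := ne_top_of_le_ne_top ENNReal.one_ne_top ht
  have hs' : s ≠ ∞ := ne_top_of_le_ne_top ht' hst
  apply ENNReal.ofReal_le_ofReal
  apply neg_le_neg
  exact Real.log_le_log (ENNReal.toReal_pos hs hs') (ENNReal.toReal_mono ht' hst)

theorem info_mul {s t : ℝ≥0∞} (hs : s ≠ 0) (ht : t ≠ 0) (hs1 : s ≤ 1) (ht1 : t ≤ 1) :
    info (s * t) = info s + info t := by
  have ht' : t ≠ ∞ := ne_top_of_le_ne_top ENNReal.one_ne_top ht1
  have hs' : s ≠ ∞ := ne_top_of_le_ne_top ENNReal.one_ne_top hs1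
  have h1 : t.toReal ≤ 1 := by simpa using ENNReal.toReal_mono ENNReal.one_ne_top ht1
  have h2 : s.toReal ≤ 1 := by simpa using ENNReal.toReal_mono ENNReal.one_ne_top hs1
  unfold info
  rw [ENNReal.toReal_mul, Real.log_mul (ENNReal.toReal_pos hs hs').ne'
    (ENNReal.toReal_pos ht ht').ne', neg_add, ENNReal.ofReal_add]
  · simpa using Real.log_nonpos ENNReal.toReal_nonneg h2
  · simpa using Real.log_nonpos ENNReal.toReal_nonneg h1

theorem ofReal_negMulLog_toReal {t : ℝ≥0∞} (ht : t ≠ ∞) :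
    ENNReal.ofReal (Real.negMulLog t.toReal) = t * info t := by
  rw [Real.negMulLog, neg_mul, ← mul_neg, ENNReal.ofReal_mul ENNReal.toReal_nonneg,
    ENNReal.ofReal_toReal ht, info]

theorem entropy_eq_tsum (p : PMF α) : entropy p = ∑' x, p x * info (p x) :=
  tsum_congr fun x => ofReal_negMulLog_toReal (PMF.apply_ne_top p x)

/-- Entropy as a mean over the sample space: entropies of different variables can then be compared
outcome by outcome. -/
theorem entropy_map (p : PMF Ω) (X : Ω → α) :
    entropy (p.map X) = ∑' ω, p ω * info (p.map X (X ω)) := by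
  rw [entropy_eq_tsum, map_apply_eq_tsum]

theorem map_apply_ne_zero {p : PMF Ω} {ω : Ω} (h : ω ∈ p.support) (X : Ω → α) :
    p.map X (X ω) ≠ 0 := by
  rw [← PMF.mem_support_iff, PMF.mem_support_map_iff]
  exact ⟨ω, h, rfl⟩

theorem tsum_mul_le_tsum_mul {p : PMF Ω} {a b : Ω → ℝ≥0∞}
    (h : ∀ ω ∈ p.support, a ω ≤ b ω) : ∑' ω, p ω * a ω ≤ ∑' ω, p ω * b ω := by
  refine ENNReal.tsum_le_tsum fun ω => ?_
  by_cases hω : p ω = 0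
  · simp [hω]
  · exact mul_le_mul_right (h ω ((PMF.mem_support_iff _ _).2 hω)) _

/-- Almost surely each fibre of `X` lies in a fibre of `Y`, so the observed value of `Y` is at least
as likely as that of `X`. -/
theorem entropy_map_le_of_factors {p : PMF Ω} {X : Ω → α} {Y : Ω → β}
    (h : ∀ ω ∈ p.support, ∀ ω' ∈ p.support, X ω = X ω' → Y ω = Y ω') :
    entropy (p.map Y) ≤ entropy (p.map X) := by
  classical
  rw [entropy_map, entropy_map]
  refine tsum_mul_le_tsum_mul fun ω hω => ?_
  refine info_anti (map_apply_ne_zero hω X) ?_ (PMF.coe_le_one _ _)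
  rw [PMF.map_apply, PMF.map_apply]
  refine ENNReal.tsum_le_tsum fun ω' => ?_
  by_cases hω' : p ω' = 0
  · simp [hω']
  · split_ifs with h1 h2
    · exact le_rfl
    · exact absurd (h ω hω ω' hω' h1) h2
    · exact zero_le
    · exact le_rfl

theorem entropy_map_eq_of_factors {p : PMF Ω} {X : Ω → α} {Y : Ω → β}
    (h : ∀ ω ∈ p.support, ∀ ω' ∈ p.support, X ω = X ω' ↔ Y ω = Y ω') :
    entropy (p.map Y) = entropy (p.map X) :=
  le_antisymm (entropy_map_le_of_factors fun a ha b hb => (h a ha b hb).1)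
    (entropy_map_le_of_factors fun a ha b hb => (h a ha b hb).2)

theorem Indep.entropy_eq {p : PMF Ω} {X : Ω → α} {Y : Ω → β} (h : Indep p X Y) :
    entropy (p.map fun ω => (X ω, Y ω)) = entropy (p.map X) + entropy (p.map Y) := by
  rw [entropy_map, entropy_map p X, entropy_map p Y, ← ENNReal.tsum_add]
  refine tsum_congr fun ω => ?_
  by_cases hω : p ω = 0
  · simp [hω]
  · rw [← mul_add, h, indepPair_apply, info_mul (map_apply_ne_zero hω X) (map_apply_ne_zero hω Y)
      (PMF.coe_le_one _ _) (PMF.coe_le_one _ _)]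

theorem entropy_indepPair (p : PMF α) (q : PMF β) :
    entropy (indepPair p q) = entropy p + entropy q := by
  have h : Indep (indepPair p q) Prod.fst Prod.snd := by
    unfold Indep
    rw [map_fst_indepPair, map_snd_indepPair]
    exact PMF.map_id _
  have := h.entropy_eq
  rwa [map_fst_indepPair, map_snd_indepPair,
    show (indepPair p q).map (fun ω => (ω.1, ω.2)) = indepPair p q from PMF.map_id _] at this

theorem tsum_map_prod_left (p : PMF Ω) (X : Ω → α) (Z : Ω → γ) (z : γ) :
    ∑' x, p.map (fun ω => (X ω, Z ω)) (x, z) = p.map Z z := by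
  classical
  simp only [PMF.map_apply]
  rw [ENNReal.tsum_comm]
  refine tsum_congr fun ω => ?_
  rw [tsum_eq_single (X ω)]
  · simp
  · intro x hx
    simp [hx]

/-- `log` inequality behind Gibbs' inequality, in self-information form. -/
theorem info_add_info_le {a b c d : ℝ≥0∞} (ha : a ≠ 0) (hb : b ≠ 0) (hc : c ≠ 0) (hd : d ≠ 0)
    (ha1 : a ≤ 1) (hb1 : b ≤ 1) (hc1 : c ≤ 1) (hd1 : d ≤ 1) :
    info a + info b + 1 ≤ info c + info d + c * d / (a * b) := by
  have pos : ∀ {t : ℝ≥0∞}, t ≠ 0 → t ≤ 1 → 0 < t.toReal := fun h h' =>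
    ENNReal.toReal_pos h (ne_top_of_le_ne_top ENNReal.one_ne_top h')
  have nn : ∀ {t : ℝ≥0∞}, t ≤ 1 → 0 ≤ -Real.log t.toReal := fun h => by
    simpa using Real.log_nonpos ENNReal.toReal_nonneg
      (by simpa using ENNReal.toReal_mono ENNReal.one_ne_top h)
  have hr : c * d / (a * b) =
      ENNReal.ofReal (c.toReal * d.toReal / (a.toReal * b.toReal)) := by
    rw [ENNReal.ofReal_div_of_pos (mul_pos (pos ha ha1) (pos hb hb1)),
      ENNReal.ofReal_mul ENNReal.toReal_nonneg, ENNReal.ofReal_mul ENNReal.toReal_nonneg]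
    simp only [ENNReal.ofReal_toReal (ne_top_of_le_ne_top ENNReal.one_ne_top ha1),
      ENNReal.ofReal_toReal (ne_top_of_le_ne_top ENNReal.one_ne_top hb1),
      ENNReal.ofReal_toReal (ne_top_of_le_ne_top ENNReal.one_ne_top hc1),
      ENNReal.ofReal_toReal (ne_top_of_le_ne_top ENNReal.one_ne_top hd1)]
  have hq : 0 < c.toReal * d.toReal / (a.toReal * b.toReal) :=
    div_pos (mul_pos (pos hc hc1) (pos hd hd1)) (mul_pos (pos ha ha1) (pos hb hb1))
  have hl := Real.log_le_sub_one_of_pos hq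
  rw [Real.log_div (mul_pos (pos hc hc1) (pos hd hd1)).ne' (mul_pos (pos ha ha1) (pos hb hb1)).ne',
    Real.log_mul (pos hc hc1).ne' (pos hd hd1).ne',
    Real.log_mul (pos ha ha1).ne' (pos hb hb1).ne'] at hl
  rw [hr, info, info, info, info, ← ENNReal.ofReal_one, ← ENNReal.ofReal_add (nn ha1) (nn hb1),
    ← ENNReal.ofReal_add (nn hc1) (nn hd1),
    ← ENNReal.ofReal_add (add_nonneg (nn ha1) (nn hb1)) zero_le_one,
    ← ENNReal.ofReal_add (add_nonneg (nn hc1) (nn hd1)) hq.le]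
  apply ENNReal.ofReal_le_ofReal
  linarith

/-- Submodularity of entropy. -/
theorem entropy_submodular (p : PMF Ω) (X : Ω → α) (Y : Ω → β) (Z : Ω → γ) :
    entropy (p.map fun ω => (X ω, Y ω, Z ω)) + entropy (p.map Z) ≤
      entropy (p.map fun ω => (X ω, Z ω)) + entropy (p.map fun ω => (Y ω, Z ω)) := by
  set XYZ := fun ω => (X ω, Y ω, Z ω)
  set XZ := fun ω => (X ω, Z ω)
  set YZ := fun ω => (Y ω, Z ω)
  -- Likelihood ratio of the law making `X` and `Y` conditionally independent given `Z` to the true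
  -- law. Its mean is at most 1, which cancels the 1 in `info_add_info_le`.
  set r : Ω → ℝ≥0∞ := fun ω => p.map XZ (XZ ω) * p.map YZ (YZ ω) /
    (p.map XYZ (XYZ ω) * p.map Z (Z ω)) with hrdef
  have hr : ∑' ω, p ω * r ω ≤ 1 := by
    have h1 := map_apply_eq_tsum p XYZ (fun t : α × β × γ =>
      p.map XZ (t.1, t.2.2) * p.map YZ t.2 / (p.map XYZ t * p.map Z t.2.2))
    rw [hrdef]
    refine (le_of_eq h1.symm).trans ?_
    calc ∑' t : α × β × γ, p.map XYZ t * (p.map XZ (t.1, t.2.2) * p.map YZ t.2 /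
          (p.map XYZ t * p.map Z t.2.2))
        ≤ ∑' t : α × β × γ, p.map XZ (t.1, t.2.2) * (p.map YZ t.2 / p.map Z t.2.2) := by
          refine ENNReal.tsum_le_tsum fun t => ?_
          by_cases h0 : p.map XYZ t = 0
          · simp [h0]
          · have ht : p.map XYZ t ≠ ∞ := PMF.apply_ne_top _ _
            rw [div_eq_mul_inv, div_eq_mul_inv, ENNReal.mul_inv (Or.inl h0) (Or.inl ht)]
            calc _ = (p.map XYZ t * (p.map XYZ t)⁻¹) *
                  (p.map XZ (t.1, t.2.2) * (p.map YZ t.2 * (p.map Z t.2.2)⁻¹)) := by ring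
              _ ≤ _ := by rw [ENNReal.mul_inv_cancel h0 ht, one_mul]
      _ = ∑' x, ∑' y, ∑' z, p.map XZ (x, z) * (p.map YZ (y, z) / p.map Z z) := by
          rw [ENNReal.tsum_prod']
          refine tsum_congr fun x => ?_
          rw [ENNReal.tsum_prod']
      _ = ∑' y, ∑' z, p.map Z z * (p.map YZ (y, z) / p.map Z z) := by
          rw [ENNReal.tsum_comm]
          refine tsum_congr fun y => ?_
          rw [ENNReal.tsum_comm]
          refine tsum_congr fun z => ?_
          rw [ENNReal.tsum_mul_right, tsum_map_prod_left]
      _ ≤ ∑' y, ∑' z, p.map YZ (y, z) :=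
          ENNReal.tsum_le_tsum fun y => ENNReal.tsum_le_tsum fun z => ENNReal.mul_div_le
      _ = 1 := by
          rw [← ENNReal.tsum_prod' (f := fun t => p.map YZ t), PMF.tsum_coe]
  have h1 : ∑' ω, p ω * (info (p.map XYZ (XYZ ω)) + info (p.map Z (Z ω)) + 1) ≤
      ∑' ω, p ω * (info (p.map XZ (XZ ω)) + info (p.map YZ (YZ ω)) + r ω) :=
    tsum_mul_le_tsum_mul fun ω hω => info_add_info_le (map_apply_ne_zero hω _)
      (map_apply_ne_zero hω _) (map_apply_ne_zero hω _) (map_apply_ne_zero hω _)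
      (PMF.coe_le_one _ _) (PMF.coe_le_one _ _) (PMF.coe_le_one _ _) (PMF.coe_le_one _ _)
  simp only [mul_add, ENNReal.tsum_add, mul_one, PMF.tsum_coe] at h1
  rw [← entropy_map, ← entropy_map, ← entropy_map, ← entropy_map] at h1
  exact (ENNReal.add_le_add_iff_right ENNReal.one_ne_top).1 (h1.trans (by gcongr))

theorem entropy_map_const (p : PMF Ω) (c : α) : entropy (p.map fun _ => c) = 0 := by
  classical
  have : p.map (fun _ => c) = PMF.pure c := PMF.map_const p c
  rw [entropy_map]
  simp [this, info]

theorem entropy_pair_le (p : PMF Ω) (X : Ω → α) (Y : Ω → β) :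
    entropy (p.map fun ω => (X ω, Y ω)) ≤ entropy (p.map X) + entropy (p.map Y) := by
  have h := entropy_submodular p X Y (fun _ => ())
  rw [entropy_map_const, add_zero] at h
  refine le_trans (entropy_map_le_of_factors ?_) (h.trans (add_le_add
    (entropy_map_le_of_factors ?_) (entropy_map_le_of_factors ?_)))
  all_goals intro ω _ ω' _; simp +contextual

/-- Gibbs' inequality. -/
theorem entropy_le_tsum_info (p q : PMF α) (h : p.support ⊆ q.support) :
    entropy p ≤ ∑' x, p x * info (q x) := by
  -- The logarithmic inequality with `b = d = 1`; the ratio `q x / p x` has mean at most 1.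
  have h1 : ∑' x, p x * (info (p x) + info 1 + 1) ≤
      ∑' x, p x * (info (q x) + info 1 + q x * 1 / (p x * 1)) :=
    tsum_mul_le_tsum_mul fun x hx => info_add_info_le hx one_ne_zero (h hx) one_ne_zero
      (PMF.coe_le_one _ _) le_rfl (PMF.coe_le_one _ _) le_rfl
  have h0 : info 1 = 0 := by simp [info]
  simp only [h0, add_zero, mul_one, mul_add, ENNReal.tsum_add, PMF.tsum_coe] at h1
  rw [← entropy_eq_tsum] at h1
  refine (ENNReal.add_le_add_iff_right ENNReal.one_ne_top).1 (h1.trans ?_)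
  gcongr
  calc ∑' x, p x * (q x / p x) ≤ ∑' x, q x :=
        ENNReal.tsum_le_tsum fun x => ENNReal.mul_div_le
    _ = 1 := PMF.tsum_coe q

/-- Concavity of entropy. -/
theorem tsum_mul_entropy_le_entropy_bind (π : PMF α) (p : α → PMF β) :
    ∑' u, π u * entropy (p u) ≤ entropy (π.bind p) := by
  calc ∑' u, π u * entropy (p u)
      ≤ ∑' u, π u * ∑' x, p u x * info (π.bind p x) := by
        refine tsum_mul_le_tsum_mul fun u hu => entropy_le_tsum_info _ _ fun x hx => ?_
        rw [PMF.mem_support_bind_iff]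
        exact ⟨u, hu, hx⟩
    _ = entropy (π.bind p) := by
        rw [entropy_eq_tsum]
        simp only [PMF.bind_apply, ← ENNReal.tsum_mul_left, ← ENNReal.tsum_mul_right]
        rw [ENNReal.tsum_comm]
        simp only [mul_assoc]

theorem entropy_uniformOfFintype [Fintype α] [Nonempty α] :
    entropy (PMF.uniformOfFintype α) = ENNReal.ofReal (Real.log (Fintype.card α)) := by
  have h : (Fintype.card α : ℝ≥0∞) ≠ 0 := by simp
  rw [entropy_eq_tsum, tsum_fintype]
  simp only [PMF.uniformOfFintype_apply, Finset.sum_const, Finset.card_univ, nsmul_eq_mul]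
  rw [← mul_assoc, ENNReal.mul_inv_cancel h (ENNReal.natCast_ne_top _), one_mul, info]
  simp

theorem entropy_le_log_card [Fintype α] [Nonempty α] (p : PMF α) :
    entropy p ≤ ENNReal.ofReal (Real.log (Fintype.card α)) := by
  refine (entropy_le_tsum_info p (PMF.uniformOfFintype α) fun x _ => by simp).trans (le_of_eq ?_)
  simp only [PMF.uniformOfFintype_apply]
  rw [ENNReal.tsum_mul_right, PMF.tsum_coe, one_mul, info]
  simp

end Entropy

/-- Some `M`-subset carries at least the average share `M / N` of a sum. -/
theorem exists_card_eq_mul_sum_le {ι : Type*} [Fintype ι] (x : ι → ℝ) {M : ℕ}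
    (hM : M ≤ Fintype.card ι) : ∃ I : Finset ι, I.card = M ∧
      (M : ℝ) * ∑ i, x i ≤ (Fintype.card ι : ℝ) * ∑ i ∈ I, x i := by
  classical
  -- Start from the whole set and repeatedly discard a smallest element, which is at most the
  -- average.
  induction hM using Nat.decreasingInduction with
  | self => exact ⟨Finset.univ, Finset.card_univ, le_rfl⟩
  | of_succ m hm ih =>
    obtain ⟨I, hI, h⟩ := ih
    have hne : I.Nonempty := Finset.card_pos.1 (by omega)
    obtain ⟨a, ha, hmin⟩ := I.exists_min_image x hne
    refine ⟨I.erase a, by rw [Finset.card_erase_of_mem ha, hI]; rfl, ?_⟩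
    have h1 : ((m : ℝ) + 1) * x a ≤ ∑ i ∈ I, x i := by
      have := I.card_nsmul_le_sum x (x a) hmin
      rw [hI, nsmul_eq_mul] at this
      exact_mod_cast this
    have h2 := Finset.add_sum_erase I x ha
    push_cast at h
    have hm0 : (0 : ℝ) ≤ m := Nat.cast_nonneg m
    have h3 : ((m : ℝ) + 1) * (m * ∑ i, x i) ≤
        ((m : ℝ) + 1) * ((Fintype.card ι : ℝ) * ∑ i ∈ I.erase a, x i) := by
      have e : ∑ i ∈ I.erase a, x i = ∑ i ∈ I, x i - x a := by linarith
      rw [e]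
      have hN : (0 : ℝ) ≤ Fintype.card ι := Nat.cast_nonneg _
      have h4 := mul_le_mul_of_nonneg_left h1 hN
      have h5 := mul_le_mul_of_nonneg_left h hm0
      nlinarith
    exact le_of_mul_le_mul_left h3 (by positivity)

/-! ### Joint entropies of families, Han's inequality, secret sharing -/

section Family

variable {Ω ω ν σ : Type*} {N : ℕ} {β : Fin N → Type*} (p : PMF Ω) (f : ∀ n, Ω → β n)

/-- The joint entropy of a subfamily. -/
def entropyOn (I : Finset (Fin N)) : ℝ≥0∞ := entropy (p.map fun w (n : I) => f n w)

theorem entropyOn_mono {I J : Finset (Fin N)} (h : I ⊆ J) :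
    entropyOn p f I ≤ entropyOn p f J := by
  refine entropy_map_le_of_factors fun ω _ ω' _ hω => funext fun n => ?_
  exact congrFun hω ⟨n, h n.2⟩

theorem entropyOn_univ : entropyOn p f Finset.univ = entropy (p.map fun w n => f n w) := by
  refine entropy_map_eq_of_factors fun ω _ ω' _ => ?_
  simp [funext_iff]

theorem entropyOn_empty : entropyOn p f ∅ = 0 := by
  have : (fun w (n : (∅ : Finset (Fin N))) => f n w) =
      fun _ => fun n => absurd n.2 (Finset.notMem_empty _) := by
    funext w n
    exact absurd n.2 (Finset.notMem_empty _)
  rw [entropyOn, this, entropy_map_const]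

/-- Diminishing returns: conditioning on more members lowers the increment contributed by member
`i`. -/
theorem entropyOn_insert_le (I J : Finset (Fin N)) (i : Fin N) (h : I ⊆ J) :
    entropyOn p f (insert i J) + entropyOn p f I ≤
      entropyOn p f (insert i I) + entropyOn p f J := by
  have h1 := entropy_submodular p (f i) (fun w (n : J) => f n w) (fun w (n : I) => f n w)
  have e1 : entropyOn p f (insert i J) =
      entropy (p.map fun w => (f i w, (fun (n : J) => f n w), fun (n : I) => f n w)) := by
    refine entropy_map_eq_of_factors fun w _ w' _ => ?_
    simp only [Prod.mk.injEq, funext_iff, Subtype.forall, Finset.mem_insert, forall_eq_or_imp]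
    exact ⟨fun H => ⟨H.1, H.2.1⟩, fun H => ⟨H.1, H.2, fun n hn => H.2 n (h hn)⟩⟩
  have e2 : entropyOn p f (insert i I) =
      entropy (p.map fun w => (f i w, fun (n : I) => f n w)) := by
    refine entropy_map_eq_of_factors fun w _ w' _ => ?_
    simp only [Prod.mk.injEq, funext_iff, Subtype.forall, Finset.mem_insert, forall_eq_or_imp]
  have e3 : entropyOn p f J =
      entropy (p.map fun w => ((fun (n : J) => f n w), fun (n : I) => f n w)) := by
    refine entropy_map_eq_of_factors fun w _ w' _ => ?_
    simp only [Prod.mk.injEq, funext_iff, Subtype.forall]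
    exact ⟨fun H => H.1, fun H => ⟨H, fun n hn => H n (h hn)⟩⟩
  rw [e1, e2, e3]
  exact h1

theorem entropyOn_le_sum (I : Finset (Fin N)) :
    entropyOn p f I ≤ ∑ n ∈ I, entropy (p.map (f n)) := by
  induction I using Finset.induction_on with
  | empty => simp [entropyOn_empty]
  | insert i I hi ih =>
    rw [Finset.sum_insert hi]
    refine le_trans ?_ (add_le_add_right ih _)
    refine le_trans (entropy_map_le_of_factors ?_)
      (entropy_pair_le p (f i) (fun w (n : I) => f n w))
    intro w _ w' _
    simp only [Prod.mk.injEq, funext_iff, Subtype.forall, Finset.mem_insert, forall_eq_or_imp]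
    exact id

/-- A form of Han's inequality: some `M`-subfamily carries at least the share `M / N` of the joint
entropy. -/
theorem exists_card_eq_mul_entropy_le {M : ℕ} (hM : M ≤ N)
    (hfin : entropyOn p f Finset.univ ≠ ∞) : ∃ I : Finset (Fin N), I.card = M ∧
      (M : ℝ) * (entropyOn p f Finset.univ).toReal ≤ N * (entropyOn p f I).toReal := by
  have fin : ∀ I, entropyOn p f I ≠ ∞ := fun I =>
    ne_top_of_le_ne_top hfin (entropyOn_mono p f I.subset_univ)
  -- Chain rule: `d i` is the entropy of member `i` given all earlier ones, so the `d i` telescope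
  -- to the joint entropy.
  set g : ℕ → ℝ := fun j => (entropyOn p f (Finset.univ.filter fun i : Fin N => i.val < j)).toReal
  set d : Fin N → ℝ := fun i => g (i.val + 1) - g i.val with hd
  have hsum : ∑ i, d i = (entropyOn p f Finset.univ).toReal := by
    rw [hd, Fin.sum_univ_eq_sum_range (fun j => g (j + 1) - g j) N, Finset.sum_range_sub]
    have h0 : g 0 = 0 := by
      have : (Finset.univ.filter fun i : Fin N => i.val < 0) = ∅ := by ext; simp
      simp only [g, this, entropyOn_empty, ENNReal.toReal_zero]
    have h1 : (Finset.univ.filter fun i : Fin N => i.val < N) = Finset.univ := by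
      ext i; simp
    rw [h0, sub_zero]
    simp only [g, h1]
  -- Adding members in increasing order, the increment inside `I` is conditioned only on the earlier
  -- members of `I`, hence is at least `d i`.
  have hge : ∀ I : Finset (Fin N), ∑ i ∈ I, d i ≤ (entropyOn p f I).toReal := by
    intro I
    induction I using Finset.induction_on_max with
    | empty => simp
    | insert i I hi ih =>
      rw [Finset.sum_insert fun h => lt_irrefl _ (hi i h)]
      have hsub : I ⊆ Finset.univ.filter fun j : Fin N => j.val < i.val := fun j hj => by
        simpa using hi j hj
      have h1 := entropyOn_insert_le p f I _ i hsub
      have h2 : insert i (Finset.univ.filter fun j : Fin N => j.val < i.val) =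
          Finset.univ.filter fun j : Fin N => j.val < i.val + 1 := by
        ext j
        simp only [Finset.mem_insert, Finset.mem_filter, Finset.mem_univ, true_and, Fin.ext_iff]
        omega
      rw [h2] at h1
      have h3 := ENNReal.toReal_mono (ENNReal.add_ne_top.2 ⟨fin _, fin _⟩) h1
      rw [ENNReal.toReal_add (fin _) (fin _), ENNReal.toReal_add (fin _) (fin _)] at h3
      simp only [hd, g] at ih ⊢
      linarith
  obtain ⟨I, hI, h⟩ := exists_card_eq_mul_sum_le d (M := M) (by simpa using hM)
  rw [hsum, Fintype.card_fin] at h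
  exact ⟨I, hI, h.trans (mul_le_mul_of_nonneg_left (hge I) (Nat.cast_nonneg N))⟩

/-- Entropy bounds for a family `f` which determines `W`, is jointly independent of `V`, has
`M`-subfamilies independent of `W`, and is determined by `(W, V, S)`. -/
theorem entropy_bounds_of_secret_sharing {M : ℕ} (hM : M < N) {W : Ω → ω} {V : Ω → ν} {S : Ω → σ}
    (hW : entropy (p.map W) ≠ ∞) (hV : entropy (p.map V) ≠ ∞) (hS : entropy (p.map S) ≠ ∞)
    (hdec : ∀ w ∈ p.support, ∀ w' ∈ p.support, (∀ n, f n w = f n w') → W w = W w')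
    (hsec : ∀ I : Finset (Fin N), I.card = M → Indep p W fun w (n : I) => f n w)
    (hind : Indep p V fun w n => f n w)
    (hfun : ∀ w w', W w = W w' → V w = V w' → S w = S w' → ∀ n, f n w = f n w') :
    (N : ℝ) * (entropy (p.map W)).toReal ≤
        (N - M) * (entropy (p.map fun w n => f n w)).toReal ∧
      (M : ℝ) * (entropy (p.map W)).toReal ≤ (N - M) * (entropy (p.map S)).toReal := by
  -- Independence splits H(V, f), so the finite term H(V) cancels and leaves H(f) ≤ H(W) + H(S).
  have h1 : entropy (p.map V) + entropy (p.map fun w n => f n w) ≤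
      entropy (p.map V) + (entropy (p.map W) + entropy (p.map S)) := by
    rw [← hind.entropy_eq]
    calc _ ≤ entropy (p.map fun w => (V w, W w, S w)) := by
          refine entropy_map_le_of_factors fun w _ w' _ h => ?_
          simp only [Prod.mk.injEq] at h ⊢
          exact ⟨h.1, funext (hfun w w' h.2.1 h.1 h.2.2)⟩
      _ ≤ _ := (entropy_pair_le p V _).trans (add_le_add_right (entropy_pair_le p W S) _)
  have h2 := (ENNReal.add_le_add_iff_left hV).1 h1
  have hf : entropy (p.map fun w n => f n w) ≠ ∞ :=
    ne_top_of_le_ne_top (ENNReal.add_ne_top.2 ⟨hW, hS⟩) h2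
  rw [← entropyOn_univ] at hf h2 ⊢
  obtain ⟨I, hI, hHan⟩ := exists_card_eq_mul_entropy_le p f hM.le hf
  have hfI : entropyOn p f I ≠ ∞ := ne_top_of_le_ne_top hf (entropyOn_mono p f I.subset_univ)
  -- The whole family determines both `W` and the subfamily, and these two are independent.
  have h3 : entropy (p.map W) + entropyOn p f I ≤ entropyOn p f Finset.univ := by
    rw [entropyOn, ← (hsec I hI).entropy_eq]
    refine entropy_map_le_of_factors fun w hw w' hw' h => ?_
    have h' : ∀ n, f n w = f n w' := fun n => congrFun h ⟨n, Finset.mem_univ n⟩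
    simp only [Prod.mk.injEq]
    exact ⟨hdec w hw w' hw' h', funext fun n => h' n⟩
  have r2 := ENNReal.toReal_mono (ENNReal.add_ne_top.2 ⟨hW, hS⟩) h2
  have r3 := ENNReal.toReal_mono hf h3
  rw [ENNReal.toReal_add hW hS] at r2
  rw [ENNReal.toReal_add hW hfI] at r3
  have hMN : (M : ℝ) < N := by exact_mod_cast hM
  have hN0 : (0 : ℝ) ≤ N := Nat.cast_nonneg N
  have r4 := mul_le_mul_of_nonneg_left r3 hN0
  have c1 : (N : ℝ) * (entropy (p.map W)).toReal ≤
        (N - M) * (entropyOn p f Finset.univ).toReal := by nlinarith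
  refine ⟨c1, ?_⟩
  have r5 := mul_le_mul_of_nonneg_left r2 (sub_nonneg.2 hMN.le)
  nlinarith

end Family

/-! ### Uniform laws and the splitting of the database -/

section Uniform

variable {α β : Type*} [Fintype α] [Nonempty α] [Fintype β] [Nonempty β]

theorem map_uniformOfFintype {f : α → β} (hf : Function.Bijective f) :
    (PMF.uniformOfFintype α).map f = PMF.uniformOfFintype β := by
  classical
  ext y
  obtain ⟨x, rfl⟩ := hf.2 y
  rw [PMF.map_apply, tsum_eq_single x]
  · simp [Fintype.card_of_bijective hf]
  · intro x' hx'
    exact if_neg fun h => hx' (hf.1 h).symm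

theorem indepPair_uniformOfFintype :
    indepPair (PMF.uniformOfFintype α) (PMF.uniformOfFintype β) =
      PMF.uniformOfFintype (α × β) := by
  ext x
  rw [indepPair_apply]
  simp only [PMF.uniformOfFintype_apply, Fintype.card_prod, Nat.cast_mul]
  rw [ENNReal.mul_inv] <;> simp

theorem eq_of_others_eq {K : ℕ} {β : Type*} {k : Fin K} {w w' : Fin K → β} (h : w k = w' k)
    (h' : others k w = others k w') : w = w' := by
  funext i
  rcases lt_trichotomy i.val k.val with hi | hi | hi
  · have := congrFun h' ⟨i.val, by omega⟩
    simpa [others, hi] using this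
  · rw [Fin.ext hi, h]
  · have := congrFun h' ⟨i.val - 1, by omega⟩
    have e : ¬ i.val - 1 < k.val := by omega
    have e' : (⟨i.val - 1 + 1, by omega⟩ : Fin K) = i := Fin.ext (by simp; omega)
    simpa [others, e, e'] using this

theorem map_apply_others_uniform {K : ℕ} (k : Fin K) :
    (PMF.uniformOfFintype (Fin K → α)).map (fun w => (w k, others k w)) =
      indepPair (PMF.uniformOfFintype α) (PMF.uniformOfFintype (Fin (K - 1) → α)) := by
  classical
  rw [indepPair_uniformOfFintype]
  apply map_uniformOfFintype
  rw [Fintype.bijective_iff_injective_and_card]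
  constructor
  · intro w w' h
    simp only [Prod.mk.injEq] at h
    exact eq_of_others_eq h.1 h.2
  · have := k.pos
    simp only [Fintype.card_fun, Fintype.card_fin, Fintype.card_prod]
    conv_lhs => rw [show K = K - 1 + 1 by omega, pow_succ']

end Uniform

theorem Indep.of_map {Ω Ω' α β : Type*} {p : PMF Ω} {φ : Ω → Ω'} {X : Ω' → α} {Y : Ω' → β}
    (h : Indep (p.map φ) X Y) : Indep p (fun ω => X (φ ω)) (fun ω => Y (φ ω)) := by
  unfold Indep at h
  rw [PMF.map_comp, PMF.map_comp, PMF.map_comp] at h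
  exact h

/-- If `Z` is independent of the parameter `g`, its conditional law is its law. -/
theorem Indep.map_fiber_eq {α β γ δ : Type*} {π : PMF α} {μ : PMF β} {g : α → γ}
    {Z : γ → β → δ}
    (h : Indep (indepPair π μ) (fun x => g x.1) (fun x => Z (g x.1) x.2))
    {c : γ} (hc : c ∈ (π.map g).support) :
    μ.map (Z c) = (indepPair π μ).map fun x => Z (g x.1) x.2 := by
  classical
  ext z
  have h1 := map_fiber_apply π μ g Z z c
  have h2 : (indepPair π μ).map (fun x => (Z (g x.1) x.2, g x.1)) =
      indepPair ((indepPair π μ).map fun x => Z (g x.1) x.2) (π.map g) := by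
    have e : (indepPair π μ).map (fun x => g x.1) = π.map g := by
      conv_rhs => rw [← map_fst_indepPair π μ, PMF.map_comp]
      rfl
    have := congrArg (PMF.map Prod.swap) h
    rw [PMF.map_comp, e] at this
    refine this.trans ?_
    ext ⟨a, b⟩
    rw [PMF.map_apply, tsum_eq_single (b, a)]
    · simp [indepPair_apply, mul_comm]
    · rintro ⟨b', a'⟩ hne
      exact if_neg fun h => hne (by simpa [and_comm, eq_comm] using h)
  rw [h2, indepPair_apply, mul_comm] at h1
  exact ((ENNReal.mul_right_inj hc (PMF.apply_ne_top _ _)).1 h1).symm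

/-! ### Converse: bounds for fixed user randomness, then averaging -/

namespace Protocol

variable {F : Type*} {N K L : ℕ} (P : Protocol F N K L)

/-- The answers to fixed queries, as a function of the database and the common randomness. -/
def answers {I : Finset (Fin N)} (q : ∀ n : I, P.Query n) (d : Database F K L × P.CommonRand) :
    ∀ n : I, P.Answer n :=
  fun n => P.answer n (q n) d.1 (P.nodeRand n d.2)

/-- The answer of one node for fixed user randomness. -/
def ans (k : Fin K) (u : P.UserRand) (n : Fin N) (d : Database F K L × P.CommonRand) :
    P.Answer n :=
  P.answer n (P.query n k u) d.1 (P.nodeRand n d.2)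

/-- The queries to the nodes in `I`, for fixed user randomness. -/
def queriesOn (I : Finset (Fin N)) (k : Fin K) (u : P.UserRand) : ∀ n : I, P.Query n :=
  fun n => P.query n k u

variable [Fintype F] [Nonempty F]

/-- The joint law of the database and the common randomness. -/
def nodeLaw : PMF (Database F K L × P.CommonRand) :=
  indepPair (PMF.uniformOfFintype (Database F K L)) P.commonLaw

theorem map_file_nodeLaw (k : Fin K) :
    P.nodeLaw.map (fun d => d.1 k) = PMF.uniformOfFintype (File F L) := by
  have h1 : P.nodeLaw.map (fun d => d.1 k) =
      (P.nodeLaw.map Prod.fst).map (fun w => w k) := by rw [PMF.map_comp]; rfl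
  have h2 : (PMF.uniformOfFintype (Database F K L)).map (fun w => w k) =
      ((PMF.uniformOfFintype (Database F K L)).map (fun w => (w k, others k w))).map
        Prod.fst := by rw [PMF.map_comp]; rfl
  rw [h1, nodeLaw, map_fst_indepPair, h2, map_apply_others_uniform, map_fst_indepPair]

variable [NeZero K]

theorem law_eq : P.law = (indepPair (indepPair (PMF.uniformOfFintype (Fin K)) P.userLaw)
    P.nodeLaw).map fun x => (x.1.1, x.1.2, x.2) := by
  simp only [law, map_indepPair, indepPair_bind, nodeLaw]
  conv_lhs => rw [indepPair]
  simp only [map_indepPair]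

theorem law_map {α : Type*} (f : P.Outcome → α) : P.law.map f =
    (PMF.uniformOfFintype (Fin K)).bind fun k => P.userLaw.bind fun u =>
      P.nodeLaw.map fun d => f (k, u, d) := by
  rw [law_eq, PMF.map_comp, map_indepPair, indepPair_bind]
  rfl

theorem law_map_node {α : Type*} (f : Database F K L × P.CommonRand → α) :
    (P.law.map fun ω => f ω.2.2) = P.nodeLaw.map f := by
  rw [law_map]
  simp [PMF.bind_const]

theorem mem_support_law (k : Fin K) {u : P.UserRand} (hu : u ∈ P.userLaw.support)
    {d : Database F K L × P.CommonRand} (hd : d ∈ P.nodeLaw.support) :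
    ((k, u, d) : P.Outcome) ∈ P.law.support := by
  rw [law_eq, PMF.mem_support_map_iff]
  exact ⟨((k, u), d), by simp only [mem_support_indepPair]; simp [hu, hd], rfl⟩

theorem fileEntropy_eq (k : Fin K) :
    P.fileEntropy k = ENNReal.ofReal (Real.log (Fintype.card (File F L))) := by
  rw [fileEntropy, ← entropy_uniformOfFintype, ← P.map_file_nodeLaw k, ← law_map_node]
  rfl

theorem law_map_common : P.law.map P.common = P.commonLaw := by
  rw [← map_snd_indepPair (PMF.uniformOfFintype (Database F K L)) P.commonLaw]
  exact P.law_map_node Prod.snd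

variable {P}

/-- The user's view contains the query scheme and the index. Given these the answers depend on `u`
no further, so `Indep.fiber` applies with this pair as parameter. -/
theorem DatabasePrivate.indep (h : P.DatabasePrivate) (k : Fin K) {u : P.UserRand}
    (hu : u ∈ P.userLaw.support) :
    Indep P.nodeLaw (fun d => others k d.1) (fun d n => P.ans k u n d) := by
  have h1 := (mutualInfo_eq_zero_iff _ _ _).1 h
  rw [law_eq] at h1
  have h2 := Indep.of_map h1
  refine Indep.fiber (γ := (Fin K → ∀ n, P.Query n) × Fin K)
    (g := fun c : Fin K × P.UserRand => (fun k n => P.query n k c.2, c.1))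
    (X := fun c (d : Database F K L × P.CommonRand) => others c.2 d.1)
    (Y := fun c (d : Database F K L × P.CommonRand) n => P.answer n (c.1 c.2 n) d.1 (P.nodeRand n d.2)) h2
    (c := (fun k n => P.query n k u, k)) ?_
  rw [PMF.mem_support_map_iff]
  exact ⟨(k, u), by rw [mem_support_indepPair]; simp [hu], rfl⟩

theorem EavesdropperSecure.indep {E : ℕ} (h : P.EavesdropperSecure E) {I : Finset (Fin N)}
    (hI : I.card ≤ E) (k : Fin K) {u : P.UserRand} (hu : u ∈ P.userLaw.support) :
    Indep P.nodeLaw (fun d => d.1) (P.answers (P.queriesOn I k u)) := by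
  have h1 := (mutualInfo_eq_zero_iff _ _ _).1 (h I hI k)
  rw [law_eq] at h1
  have h2 := (Indep.of_map h1).comp id Prod.swap
  refine Indep.fiber (g := fun c : Fin K × P.UserRand => P.queriesOn I k c.2)
    (X := fun c d => d.1) (Y := fun c d => P.answers c d) h2 ?_
  rw [PMF.mem_support_map_iff]
  exact ⟨(k, u), by rw [mem_support_indepPair]; simp [hu], rfl⟩

theorem UserPrivate.map_queriesOn_eq {T : ℕ} (h : P.UserPrivate T) {I : Finset (Fin N)}
    (hI : I.card = T) (k k' : Fin K) :
    P.userLaw.map (P.queriesOn I k) = P.userLaw.map (P.queriesOn I k') := by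
  -- Only the queries in the colluders' view are needed: their law given `κ = k` is their
  -- unconditional law.
  have h1 := Indep.comp ((mutualInfo_eq_zero_iff _ _ _).1 (h I hI)) id fun y => y.1
  have h2 : ∀ k, (indepPair P.userLaw P.nodeLaw).map (fun x => P.queriesOn I k x.1) =
      P.law.map fun ω => P.queriesOn I ω.1 ω.2.1 := fun k =>
    Indep.map_fiber_eq (g := id) (Z := fun k (x : P.UserRand × _) => P.queriesOn I k x.1) h1
      (c := k) (by simp [PMF.map_id])
  have h3 : ∀ k, (indepPair P.userLaw P.nodeLaw).map (fun x => P.queriesOn I k x.1) =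
      P.userLaw.map (P.queriesOn I k) := fun k => by
    conv_rhs => rw [← map_fst_indepPair P.userLaw P.nodeLaw, PMF.map_comp]
    rfl
  rw [← h3, ← h3, h2, h2]

theorem IsTESPIR.indep_file_answers {T E : ℕ} (h : P.IsTESPIR T E) (hK : 2 ≤ K)
    {I : Finset (Fin N)} (hI : I.card = max T E) (k : Fin K) {u : P.UserRand}
    (hu : u ∈ P.userLaw.support) :
    Indep P.nodeLaw (fun d => d.1 k) (fun d (n : I) => P.ans k u n d) := by
  rcases le_total T E with hTE | hTE
  · rw [max_eq_right hTE] at hI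
    exact (h.eavesdropperSecure.indep hI.le k hu).comp (fun w => w k) id
  · rw [max_eq_left hTE] at hI
    have : Nontrivial (Fin K) := Fin.nontrivial_iff_two_le.2 hK
    obtain ⟨k', hk'⟩ := exists_ne k
    -- Equal query laws have equal supports; this yields the `u'` that requests `k'` with the same
    -- queries to `I`.
    have h1 : P.queriesOn I k u ∈ (P.userLaw.map (P.queriesOn I k')).support := by
      rw [h.userPrivate.map_queriesOn_eq hI k' k, PMF.mem_support_map_iff]
      exact ⟨u, hu, rfl⟩
    obtain ⟨u', hu', hq⟩ := (PMF.mem_support_map_iff _ _ _).1 h1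
    -- Position of file `k` after deletion of file `k'`: it moves down by one exactly when `k' < k`.
    obtain ⟨i, hi⟩ : ∃ i, ∀ w : Database F K L, others k' w i = w k := by
      rcases lt_or_gt_of_ne (fun e => hk' (Fin.ext e) : k'.val ≠ k.val) with hlt | hlt
      · refine ⟨⟨k.val - 1, by omega⟩, fun w => ?_⟩
        have e : ¬ k.val - 1 < k'.val := by omega
        have e' : (⟨k.val - 1 + 1, by omega⟩ : Fin K) = k := Fin.ext (by simp; omega)
        simp [others, e, e']
      · exact ⟨⟨k.val, by omega⟩, fun w => by simp [others, hlt]⟩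
    have h2 := (h.databasePrivate.indep k' hu').comp (fun o => o i) (fun a (n : I) => a n)
    simp only [hi] at h2
    have e : (fun d (n : I) => P.ans k u n d) =
        (fun d (n : I) => P.ans k' u' n d) := by
      funext d n
      have := congrFun hq n
      simp only [queriesOn] at this
      simp only [ans, this]
    rw [e]
    exact h2

theorem IsTESPIR.entropy_bounds {T E : ℕ} (h : P.IsTESPIR T E) (hK : 2 ≤ K) (hN : max T E < N)
    (k : Fin K) (hS : entropy P.commonLaw ≠ ∞) {u : P.UserRand} (hu : u ∈ P.userLaw.support) :
    (N : ℝ) * (P.fileEntropy k).toReal ≤ (N - (max T E : ℕ)) *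
        (entropy (P.nodeLaw.map fun d n => P.ans k u n d)).toReal ∧
      ((max T E : ℕ) : ℝ) * (P.fileEntropy k).toReal ≤
        (N - (max T E : ℕ)) * (entropy P.commonLaw).toReal := by
  classical
  have hW : P.fileEntropy k = entropy (P.nodeLaw.map fun d => d.1 k) := by
    rw [← law_map_node]; rfl
  have hS' : entropy P.commonLaw = entropy (P.nodeLaw.map Prod.snd) := by
    rw [nodeLaw, map_snd_indepPair]
  rw [hW, hS']
  refine entropy_bounds_of_secret_sharing P.nodeLaw (P.ans k u) hN (V := fun d => others k d.1)
    ?_ ?_ ?_ ?_ ?_ ?_ ?_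
  · exact ne_top_of_le_ne_top ENNReal.ofReal_ne_top (entropy_le_log_card _)
  · exact ne_top_of_le_ne_top ENNReal.ofReal_ne_top (entropy_le_log_card _)
  · rwa [← hS']
  · obtain ⟨dec, hdec⟩ := h.decodable k
    intro d hd d' hd' he
    have h1 := hdec _ (P.mem_support_law k hu hd)
    have h2 := hdec _ (P.mem_support_law k hu hd')
    have h3 : P.allA k (k, u, d) = P.allA k (k, u, d') := funext he
    have h4 : P.queryScheme (k, u, d) = P.queryScheme (k, u, d') := rfl
    rw [h3, h4, h2] at h1
    exact h1.symm
  · exact fun I hI => h.indep_file_answers hK hI k hu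
  · exact h.databasePrivate.indep k hu
  · intro d d' hw ho hs n
    rw [Prod.ext (eq_of_others_eq hw ho) hs]

theorem fileEntropy_pos [Nontrivial F] (hL : 1 ≤ L) (k : Fin K) :
    0 < (P.fileEntropy k).toReal := by
  have : NeZero L := ⟨by omega⟩
  rw [fileEntropy_eq, ENNReal.toReal_ofReal (Real.log_natCast_nonneg _)]
  exact Real.log_pos (by exact_mod_cast Fintype.one_lt_card)

theorem fileEntropy_ne_top (k : Fin K) : P.fileEntropy k ≠ ∞ := by
  rw [fileEntropy_eq]
  exact ENNReal.ofReal_ne_top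

theorem entropy_commonLaw_eq [Nontrivial F] (hL : 1 ≤ L) {k : Fin K} {ρ : ℝ≥0}
    (hρ : P.secrecyRate k = ρ) : entropy P.commonLaw = ρ * P.fileEntropy k := by
  rw [← hρ, secrecyRate, law_map_common, ENNReal.div_mul_cancel _ (fileEntropy_ne_top k)]
  exact (ENNReal.toReal_pos_iff.1 (fileEntropy_pos hL k)).1.ne'

theorem IsTESPIR.secrecyRate_ge [Nontrivial F] {T E : ℕ} (h : P.IsTESPIR T E) (hK : 2 ≤ K)
    (hN : max T E < N) (hL : 1 ≤ L) {k : Fin K} {ρ : ℝ≥0} (hρ : P.secrecyRate k = ρ) :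
    ((max T E : ℕ) : ℝ) / ((N : ℝ) - ((max T E : ℕ) : ℝ)) ≤ (ρ : ℝ) := by
  have hS := entropy_commonLaw_eq hL hρ
  have hMN : ((max T E : ℕ) : ℝ) < N := by exact_mod_cast hN
  obtain ⟨u, hu⟩ := P.userLaw.support_nonempty
  have hb := (h.entropy_bounds hK hN k
    (hS ▸ ENNReal.mul_ne_top ENNReal.coe_ne_top (fileEntropy_ne_top k)) hu).2
  rw [hS, ENNReal.toReal_mul, ENNReal.coe_toReal] at hb
  rw [div_le_iff₀ (by linarith)]
  refine le_of_mul_le_mul_right (hb.trans (le_of_eq ?_)) (fileEntropy_pos (P := P) hL k)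
  ring

theorem IsTESPIR.rate_le [Nontrivial F] {T E : ℕ} (h : P.IsTESPIR T E) (hK : 2 ≤ K)
    (hN : max T E < N) (hL : 1 ≤ L) {k : Fin K} {ρ : ℝ≥0} (hρ : P.secrecyRate k = ρ) :
    P.rate k ≤ ENNReal.ofReal (1 - ((max T E : ℕ) : ℝ) / (N : ℝ)) := by
  have hS := entropy_commonLaw_eq hL hρ
  have hMN : ((max T E : ℕ) : ℝ) < N := by exact_mod_cast hN
  have hN0 : (0 : ℝ) < N := lt_of_le_of_lt (Nat.cast_nonneg _) hMN
  have hS' : entropy P.commonLaw ≠ ∞ :=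
    hS ▸ ENNReal.mul_ne_top ENNReal.coe_ne_top (fileEntropy_ne_top k)
  set x := (P.fileEntropy k).toReal with hx
  set M : ℝ := ((max T E : ℕ) : ℝ) with hM
  -- The joint entropy bound for fixed `u`, weakened by subadditivity to a sum over the nodes.
  have hu : ∀ u ∈ P.userLaw.support, ENNReal.ofReal (N * x / (N - M)) ≤
      ∑ n, entropy (P.nodeLaw.map (P.ans k u n)) := by
    intro u hu
    have hb := (h.entropy_bounds hK hN k hS' hu).1
    refine le_trans (ENNReal.ofReal_le_ofReal ?_) (ENNReal.ofReal_toReal_le.trans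
      ((entropyOn_univ P.nodeLaw (P.ans k u)).symm.le.trans (entropyOn_le_sum _ _ _)))
    rw [div_le_iff₀ (by linarith), mul_comm _ ((N : ℝ) - M)]
    exact hb
  have hsum : ENNReal.ofReal (N * x / (N - M)) ≤ ∑ n, entropy (P.law.map (P.A k n)) := by
    calc ENNReal.ofReal (N * x / (N - M))
        = ∑' u, P.userLaw u * ENNReal.ofReal (N * x / (N - M)) := by
          rw [ENNReal.tsum_mul_right, PMF.tsum_coe, one_mul]
      _ ≤ ∑' u, P.userLaw u * ∑ n, entropy (P.nodeLaw.map (P.ans k u n)) :=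
          tsum_mul_le_tsum_mul hu
      _ = ∑ n, ∑' u, P.userLaw u * entropy (P.nodeLaw.map (P.ans k u n)) := by
          simp only [Finset.mul_sum]
          exact Summable.tsum_finsetSum fun _ _ => ENNReal.summable
      _ ≤ ∑ n, entropy (P.law.map (P.A k n)) := by
          refine Finset.sum_le_sum fun n _ => ?_
          refine (tsum_mul_entropy_le_entropy_bind _ _).trans (le_of_eq ?_)
          rw [law_map]
          exact congrArg entropy (PMF.bind_const (PMF.uniformOfFintype (Fin K))
            (P.userLaw.bind fun u => P.nodeLaw.map (P.ans k u n))).symm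
  refine ENNReal.div_le_of_le_mul (le_trans ?_ (mul_le_mul_right hsum _))
  rw [← ENNReal.ofReal_mul (by rw [sub_nonneg, div_le_one hN0]; exact hMN.le),
    show (1 - M / N) * (N * x / (N - M)) = x by
      have : (N : ℝ) - M ≠ 0 := by linarith
      field_simp, hx, ENNReal.ofReal_toReal (fileEntropy_ne_top k)]

end Protocol

theorem map_uniformOfFintype_affine {A B : Type*} [AddGroup A] [Fintype A] [Nonempty A]
    [AddGroup B] [Fintype B] [Nonempty B] (f : A → B) (hadd : ∀ x y, f (x + y) = f x + f y)
    (hf : Function.Surjective f) (b : B) :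
    (PMF.uniformOfFintype A).map (fun a => f a + b) = PMF.uniformOfFintype B := by
  classical
  set q := (PMF.uniformOfFintype A).map (fun a => f a + b) with hq
  -- Translating the uniform input by a preimage of `y` translates the output by `y`, so the law is
  -- translation invariant.
  have hconst : ∀ y, q y = q 0 := by
    intro y
    obtain ⟨a, ha⟩ := hf y
    have h1 : q = q.map (fun z => y + z) := by
      conv_lhs => rw [hq, ← map_uniformOfFintype (AddGroup.addLeft_bijective a)]
      rw [hq, PMF.map_comp, PMF.map_comp]
      congr 1
      funext x
      simp [hadd, ha, add_assoc]
    conv_lhs => rw [h1]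
    rw [PMF.map_apply, tsum_eq_single 0]
    · simp
    · intro z hz
      exact if_neg fun h => hz (by simpa using h)
  have hsum := q.tsum_coe
  rw [tsum_fintype] at hsum
  simp only [hconst, Finset.sum_const, Finset.card_univ, nsmul_eq_mul] at hsum
  ext y
  rw [hconst, PMF.uniformOfFintype_apply]
  exact ENNReal.eq_inv_of_mul_eq_one_left (by rw [mul_comm]; exact hsum)

/-- Every nonnegative real is the entropy of some finite distribution. -/
theorem exists_entropy_eq {h : ℝ} (hh : 0 ≤ h) :
    ∃ (n : ℕ) (p : PMF (Fin (n + 1))), entropy p = ENNReal.ofReal h := by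
  -- This makes log (n + 1) ≥ h. Entropy is continuous along the segment from a point mass to the
  -- uniform law, so it takes the value `h`.
  obtain ⟨n, hn⟩ := exists_nat_ge (Real.exp h)
  set w : ℝ → Fin (n + 1) → ℝ := fun t i => (1 - t) * (if i = 0 then 1 else 0) + t / (n + 1)
    with hw
  have hn1 : (0 : ℝ) < n + 1 := by positivity
  have hw0 : ∀ t ∈ Set.Icc (0 : ℝ) 1, ∀ i, 0 ≤ w t i := by
    intro t ht i
    have h1 : 0 ≤ 1 - t := by linarith [ht.2]
    have h2 := ht.1
    simp only [hw]
    split_ifs <;> positivity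
  have hw1 : ∀ t, ∑ i, w t i = 1 := by
    intro t
    simp only [hw, Finset.sum_add_distrib, ← Finset.mul_sum]
    simp
    field_simp
    ring
  set g : ℝ → ℝ := fun t => ∑ i, Real.negMulLog (w t i)
  have hg : Continuous g := by
    refine continuous_finsetSum _ fun i _ => Real.continuous_negMulLog.comp ?_
    simp only [hw]
    fun_prop
  have g0 : g 0 = 0 := by
    refine Finset.sum_eq_zero fun i _ => ?_
    simp only [hw]
    split_ifs <;> simp
  have g1 : h ≤ g 1 := by
    have e : g 1 = Real.log (n + 1) := by
      simp [g, hw, Real.negMulLog]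
      field_simp
    rw [e, Real.le_log_iff_exp_le hn1]
    linarith
  obtain ⟨t, ht, hgt⟩ := intermediate_value_Icc zero_le_one hg.continuousOn
    (show h ∈ Set.Icc (g 0) (g 1) from ⟨g0.le.trans hh, g1⟩)
  refine ⟨n, PMF.ofFintype (fun i => ENNReal.ofReal (w t i)) ?_, ?_⟩
  · rw [← ENNReal.ofReal_sum_of_nonneg fun i _ => hw0 t ht i, hw1, ENNReal.ofReal_one]
  · rw [entropy, tsum_fintype, ← hgt]
    refine Eq.trans ?_ (ENNReal.ofReal_sum_of_nonneg ?_).symm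
    · refine Finset.sum_congr rfl fun i _ => ?_
      rw [PMF.ofFintype_apply, ENNReal.toReal_ofReal (hw0 t ht i)]
    · intro i _
      refine Real.negMulLog_nonneg (hw0 t ht i) ?_
      rw [← hw1 t]
      exact Finset.single_le_sum (fun j _ => hw0 t ht j) (Finset.mem_univ i)

/-! ### Evaluation and interpolation of polynomials -/

section Codes

variable {G : Type*} [Field G] {N M : ℕ}

/-- Evaluation at `x` of the polynomial of degree less than `M` with coefficients `c`. -/
def lowEval (x : G) (c : Fin M → G) : G := ∑ i : Fin M, c i * x ^ i.val

/-- Evaluation at `x` of the polynomial `∑ d j X ^ (M + j)`. -/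
def highEval (M : ℕ) {J : ℕ} (x : G) (d : Fin J → G) : G := ∑ j : Fin J, d j * x ^ (M + j.val)

theorem lowEval_add (x : G) (c c' : Fin M → G) :
    lowEval x (c + c') = lowEval x c + lowEval x c' := by
  simp [lowEval, add_mul, Finset.sum_add_distrib]

theorem lowEval_smul (x a : G) (c : Fin M → G) : lowEval x (a • c) = a * lowEval x c := by
  simp [lowEval, Finset.mul_sum, mul_assoc]

theorem lowEval_sum {ι : Type*} (s : Finset ι) (x : G) (c : ι → Fin M → G) :
    lowEval x (∑ i ∈ s, c i) = ∑ i ∈ s, lowEval x (c i) := by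
  simp only [lowEval, Finset.sum_apply, Finset.sum_mul]
  exact Finset.sum_comm

/-- Lagrange interpolation; together with `map_uniformOfFintype_affine` it makes any at most `M`
shares uniform. -/
theorem lowEval_surjective (x : Fin N ↪ G) {I : Finset (Fin N)} (hI : I.card ≤ M) :
    Function.Surjective fun (c : Fin M → G) (n : I) => lowEval (x n) c := by
  classical
  intro v
  rcases Nat.eq_zero_or_pos M with rfl | hM
  · have : I = ∅ := Finset.card_eq_zero.1 (Nat.le_zero.1 hI)
    subst this
    exact ⟨0, funext fun n => absurd n.2 (Finset.notMem_empty _)⟩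
  · set r : Fin N → G := fun n => if h : n ∈ I then v ⟨n, h⟩ else 0
    set p := Lagrange.interpolate I x r
    have hinj : Set.InjOn x I := x.injective.injOn
    have hdeg : p.natDegree < M := by
      by_cases hp : p = 0
      · rw [hp]; simpa using hM
      · rw [Polynomial.natDegree_lt_iff_degree_lt hp]
        exact (Lagrange.degree_interpolate_lt r hinj).trans_le (by exact_mod_cast hI)
    refine ⟨fun i => p.coeff i, funext fun n => ?_⟩
    have h1 := Lagrange.eval_interpolate_at_node r hinj n.2
    rw [Polynomial.eval_eq_sum_range' hdeg] at h1
    exact (Fin.sum_univ_eq_sum_range (fun i => p.coeff i * x n ^ i) M).trans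
      (h1.trans (by simp [r]))

/-- The difference polynomial has degree less than `N` and vanishes at `N` distinct points, so it is
zero; its coefficients from degree `M` on are `d - d'`. -/
theorem eq_of_lowEval_add_highEval_eq (hM : M ≤ N) (x : Fin N ↪ G) {c c' : Fin M → G}
    {d d' : Fin (N - M) → G}
    (h : ∀ n, lowEval (x n) c + highEval M (x n) d = lowEval (x n) c' + highEval M (x n) d') :
    d = d' := by
  classical
  set p : Polynomial G := ∑ i : Fin M, Polynomial.C (c i - c' i) * Polynomial.X ^ i.val +
    ∑ j : Fin (N - M), Polynomial.C (d j - d' j) * Polynomial.X ^ (M + j.val) with hp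
  have hdeg : p.degree < (Finset.univ : Finset (Fin N)).card := by
    rw [Finset.card_univ, Fintype.card_fin, ← Polynomial.mem_degreeLT]
    refine Submodule.add_mem _ (Submodule.sum_mem _ fun i _ => ?_)
      (Submodule.sum_mem _ fun j _ => ?_)
    all_goals
      rw [Polynomial.mem_degreeLT]
      refine (Polynomial.degree_C_mul_X_pow_le _ _).trans_lt ?_
      norm_cast
      omega
  have heval : ∀ n ∈ (Finset.univ : Finset (Fin N)), p.eval (x n) = 0 := by
    intro n _
    have := h n
    simp only [lowEval, highEval] at this
    simp only [hp, Polynomial.eval_add, Polynomial.eval_finsetSum, Polynomial.eval_mul,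
      Polynomial.eval_C, Polynomial.eval_pow, Polynomial.eval_X, sub_mul,
      Finset.sum_sub_distrib]
    linear_combination this
  have h0 := Polynomial.eq_zero_of_degree_lt_of_eval_index_eq_zero _ x.injective.injOn hdeg heval
  funext j
  have hc := congrArg (fun q => Polynomial.coeff q (M + j.val)) h0
  simp only [hp, Polynomial.coeff_add, Polynomial.finsetSum_coeff, Polynomial.coeff_C_mul,
    Polynomial.coeff_X_pow, Polynomial.coeff_zero] at hc
  rw [Finset.sum_eq_zero, zero_add, Finset.sum_eq_single j] at hc
  · simpa [sub_eq_zero] using hc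
  · intro b _ hb
    rw [if_neg, mul_zero]
    exact fun e => hb (Fin.ext (by omega))
  · simp
  · intro i _
    rw [if_neg, mul_zero]
    omega

end Codes

/-! ### Sufficient criteria for privacy -/

namespace Protocol

section Criteria

variable {F : Type*} {N K L : ℕ} {P : Protocol F N K L} [Fintype F] [Nonempty F] [NeZero K]

/-- The law of `X` is the same on all fibres, so mixing over `(k, u)` preserves the product form
even though `ν` varies. -/
theorem mutualInfo_eq_zero_of_fibers {α β : Type*} {X : P.Outcome → α} {Y : P.Outcome → β}
    (a : PMF α)
    (h : ∀ k u, ∃ ν, P.nodeLaw.map (fun d => (X (k, u, d), Y (k, u, d))) = indepPair a ν) :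
    mutualInfo P.law X Y = 0 := by
  choose ν hν using h
  refine mutualInfo_eq_zero_of_eq_indepPair (a := a)
    (b := (PMF.uniformOfFintype (Fin K)).bind fun k => P.userLaw.bind (ν k)) ?_
  rw [law_map]
  simp only [hν]
  simp only [indepPair, PMF.map_bind]
  rw [PMF.bind_comm a]
  refine congrArg _ (funext fun k => ?_)
  rw [PMF.bind_comm a]

/-- Given the queries, the rest of the colluders' view is computed from the database and `S`, which
are independent of the index. -/
theorem userPrivate_of_map_queriesOn_eq {T : ℕ}
    (h : ∀ I : Finset (Fin N), I.card = T → ∃ ν, ∀ k, P.userLaw.map (P.queriesOn I k) = ν) :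
    P.UserPrivate T := by
  intro I hI
  obtain ⟨ν, hν⟩ := h I hI
  refine mutualInfo_eq_zero_of_eq_indepPair (a := PMF.uniformOfFintype (Fin K))
    (b := ν.bind fun q => P.nodeLaw.map fun d => (q, P.answers q d, d.1, d.2)) ?_
  rw [law_map, indepPair]
  refine congrArg _ (funext fun k => ?_)
  rw [← hν k, PMF.bind_map, PMF.map_bind]
  refine congrArg _ (funext fun u => ?_)
  simp only [Function.comp_apply, PMF.map_comp]
  rfl

end Criteria

end Protocol

theorem map_add_high {G : Type*} [Field G] [Fintype G] {N M : ℕ} (x : Fin N ↪ G)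
    {I : Finset (Fin N)} (hI : I.card ≤ M) (b : I → G) :
    (PMF.uniformOfFintype (Fin M → G)).map (fun c (n : I) => lowEval (x n) c + b n) =
      PMF.uniformOfFintype (I → G) :=
  map_uniformOfFintype_affine (fun c (n : I) => lowEval (x n) c)
    (fun c c' => funext fun _ => lowEval_add _ c c') (lowEval_surjective x hI) b

/-! ### The polynomial scheme and its properties -/

section Scheme

variable {F G X : Type} [Field G] [Fintype G] {N : ℕ} (K : ℕ) {L : ℕ} (M : ℕ)
  (x : Fin N ↪ G) (e : File F L ≃ (Fin (N - M) → G)) (noise : PMF X)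

/-- The polynomial retrieval scheme. The queries are evaluations of random polynomials of degree
less than `M`, shifted by `X ^ (M + j)` at the symbols of the desired file; the answers are inner
products with the database, masked by a random polynomial of degree less than `M`. The common
randomness contains an unused component of law `noise`. -/
def polyScheme : Protocol F N K L where
  UserRand := Fin K → Fin (N - M) → Fin M → G
  userLaw := PMF.uniformOfFintype _
  CommonRand := (Fin M → G) × X
  commonLaw := indepPair (PMF.uniformOfFintype _) noise
  NodeRand _ := G
  nodeRand n s := lowEval (x n) s.1
  Query _ := Fin K → Fin (N - M) → G
  query n k u := fun i j => lowEval (x n) (u i j) + if i = k then x n ^ (M + j.val) else 0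
  Answer _ := G
  answer _ q w s := s + ∑ i, ∑ j, e (w i) j * q i j

variable {K M x e noise}

/-- The mask of the answers induced by the random part of the queries. -/
def queryMask (e : File F L ≃ (Fin (N - M) → G)) (u : Fin K → Fin (N - M) → Fin M → G)
    (w : Database F K L) : Fin M → G := ∑ i, ∑ j, e (w i) j • u i j

/-- By linearity the random parts of the queries disturb only the coefficients below degree `M`,
which the node mask hides; the shifts select the desired file. -/
theorem polyScheme_ans (k : Fin K) (u : Fin K → Fin (N - M) → Fin M → G) (n : Fin N)
    (d : Database F K L × ((Fin M → G) × X)) :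
    (polyScheme K M x e noise).ans k u n d =
      lowEval (x n) (d.2.1 + queryMask e u d.1) + highEval M (x n) (e (d.1 k)) := by
  simp only [Protocol.ans, polyScheme, lowEval_add, queryMask, lowEval_sum, lowEval_smul,
    highEval, mul_add, Finset.sum_add_distrib, add_assoc]
  congr 2
  rw [Finset.sum_eq_single k]
  · simp
  · intro i _ hi
    simp [hi]
  · simp

theorem map_mask (w : Fin M → G) :
    (PMF.uniformOfFintype (Fin M → G)).map (fun c => c + w) =
      PMF.uniformOfFintype (Fin M → G) :=
  map_uniformOfFintype_affine id (fun _ _ => rfl) Function.surjective_id w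

variable [Fintype F] [Nonempty F]

theorem polyScheme_nodeLaw_map {α : Type*} (f : Database F K L → (Fin M → G) → α) :
    ((polyScheme K M x e noise).nodeLaw.map fun d => f d.1 d.2.1) =
      (PMF.uniformOfFintype (Database F K L)).bind fun w =>
        (PMF.uniformOfFintype (Fin M → G)).map (f w) := by
  rw [Protocol.nodeLaw, map_indepPair]
  refine congrArg _ (funext fun w => ?_)
  conv_rhs => rw [← map_fst_indepPair (PMF.uniformOfFintype (Fin M → G)) noise, PMF.map_comp]
  rfl

variable [NeZero K]

theorem polyScheme_decodable (hM : M ≤ N) : (polyScheme K M x e noise).Decodable := by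
  classical
  intro k
  -- Any choice of high coefficients explaining the answers will do, since they are unique.
  refine ⟨fun _ a => e.symm (Classical.epsilon fun d => ∃ c : Fin M → G,
    ∀ n, a n = lowEval (x n) c + highEval M (x n) d), ?_⟩
  rintro ⟨k₀, u, d⟩ -
  rw [Equiv.symm_apply_eq]
  have h1 : ∀ n, (polyScheme K M x e noise).allA k (k₀, u, d) n =
      lowEval (x n) (d.2.1 + queryMask e u d.1) + highEval M (x n) (e (d.1 k)) :=
    fun n => polyScheme_ans k u n d
  have h2 : ∃ y, ∃ c : Fin M → G, ∀ n, (polyScheme K M x e noise).allA k (k₀, u, d) n =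
      lowEval (x n) c + highEval M (x n) y := ⟨_, _, h1⟩
  obtain ⟨c, hc⟩ := Classical.epsilon_spec h2
  exact eq_of_lowEval_add_highEval_eq hM x fun n => (hc n).symm.trans (h1 n)

theorem polyScheme_userPrivate {T : ℕ} (hT : T ≤ M) :
    (polyScheme K M x e noise).UserPrivate T := by
  classical
  refine Protocol.userPrivate_of_map_queriesOn_eq fun I hI =>
    ⟨PMF.uniformOfFintype (I → Fin K → Fin (N - M) → G), fun k => ?_⟩
  refine map_uniformOfFintype_affine
    (fun (u : Fin K → Fin (N - M) → Fin M → G) (n : I) i j => lowEval (x n) (u i j))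
    (fun u u' => ?_) (fun v => ?_)
    (fun n i j => if i = k then x n ^ (M + j.val) else 0)
  · funext n i j
    exact lowEval_add _ _ _
  · have h := fun i j => lowEval_surjective x (hI.le.trans hT) (fun n : I => v n i j)
    choose c hc using h
    exact ⟨c, funext fun n => funext fun i => funext fun j => congrFun (hc i j) n⟩

theorem polyScheme_databasePrivate : (polyScheme K M x e noise).DatabasePrivate := by
  refine Protocol.mutualInfo_eq_zero_of_fibers (PMF.uniformOfFintype (Fin (K - 1) → File F L))
    fun k u => ?_
  -- The user's view as a function of the desired file `v` and the low coefficients `c`. The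
  -- database and `S` given to `queryScheme` are placeholders: the queries depend on `u` alone.
  set Φ : File F L → (Fin M → G) → _ := fun v c =>
    ((fun n => lowEval (x n) c + highEval M (x n) (e v) : Fin N → G),
      (polyScheme K M x e noise).queryScheme (k, u, (fun _ => v, (c, noise.support_nonempty.some))),
      k) with hΦ
  refine ⟨(PMF.uniformOfFintype (File F L)).bind fun v =>
    (PMF.uniformOfFintype (Fin M → G)).map (Φ v), ?_⟩
  have h1 := polyScheme_nodeLaw_map (K := K) (x := x) (e := e) (noise := noise)
    (fun w s => (others k w, Φ (w k) (s + queryMask e u w)))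
  -- For each database the uniform mask absorbs the shift, so the other files no longer enter the
  -- view.
  have h2 : ∀ w : Database F K L, (PMF.uniformOfFintype (Fin M → G)).map
      (fun s => (others k w, Φ (w k) (s + queryMask e u w))) =
      (PMF.uniformOfFintype (Fin M → G)).map (fun c => (others k w, Φ (w k) c)) := by
    intro w
    conv_rhs => rw [← map_mask (queryMask e u w), PMF.map_comp]
    rfl
  simp only [h2] at h1
  have h3 : ((PMF.uniformOfFintype (Database F K L)).bind fun w =>
      (PMF.uniformOfFintype (Fin M → G)).map fun c => (others k w, Φ (w k) c)) =
      ((PMF.uniformOfFintype (Database F K L)).map fun w => (w k, others k w)).bind fun y =>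
        (PMF.uniformOfFintype (Fin M → G)).map fun c => (y.2, Φ y.1 c) := by
    rw [PMF.bind_map]
    rfl
  rw [h3, map_apply_others_uniform, indepPair_bind] at h1
  refine Eq.trans ?_ (h1.trans ?_)
  · refine congrArg (fun f => PMF.map f _) (funext fun d => ?_)
    refine Prod.ext rfl (Prod.ext (funext fun n => ?_) rfl)
    exact polyScheme_ans k u n d
  · rw [PMF.bind_comm, indepPair]
    refine congrArg _ (funext fun o => ?_)
    rw [PMF.map_bind]
    exact congrArg _ (funext fun v => (PMF.map_comp _ _ _).symm)

theorem polyScheme_eavesdropperSecure {E : ℕ} (hE : E ≤ M) :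
    (polyScheme K M x e noise).EavesdropperSecure E := by
  classical
  intro I hI k
  refine Protocol.mutualInfo_eq_zero_of_fibers (PMF.uniformOfFintype (Database F K L))
    fun k₀ u => ?_
  refine ⟨(PMF.uniformOfFintype (I → G)).map
    fun a => ((polyScheme K M x e noise).queriesOn I k u, a), ?_⟩
  have h1 := polyScheme_nodeLaw_map (K := K) (x := x) (e := e) (noise := noise)
    (fun w s => (w, (polyScheme K M x e noise).queriesOn I k u,
      fun n : I => lowEval (x n) s +
        (lowEval (x n) (queryMask e u w) + highEval M (x n) (e (w k)))))
  refine Eq.trans ?_ (h1.trans ?_)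
  · refine congrArg (fun f => PMF.map f _) (funext fun d => ?_)
    refine Prod.ext rfl (Prod.ext rfl (funext fun n => ?_))
    refine (polyScheme_ans k u n d).trans ?_
    rw [lowEval_add, add_assoc]
  · rw [indepPair]
    refine congrArg _ (funext fun w => ?_)
    rw [← map_add_high x (hI.trans hE)
      fun n => lowEval (x n) (queryMask e u w) + highEval M (x n) (e (w k))]
    exact ((congrArg (PMF.map _) (PMF.map_comp _ _ _)).trans (PMF.map_comp _ _ _)).symm

theorem polyScheme_isTESPIR {T E : ℕ} (hM : M ≤ N) (hT : T ≤ M) (hE : E ≤ M) :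
    (polyScheme K M x e noise).IsTESPIR T E :=
  ⟨polyScheme_decodable hM, polyScheme_userPrivate hT, polyScheme_databasePrivate,
    polyScheme_eavesdropperSecure hE⟩

theorem polyScheme_fileEntropy (hM : M ≤ N) (k : Fin K) :
    (polyScheme K M x e noise).fileEntropy k =
      ENNReal.ofReal (((N : ℝ) - M) * Real.log (Fintype.card G)) := by
  rw [Protocol.fileEntropy_eq, Fintype.card_congr e]
  simp [Nat.cast_sub hM]

theorem polyScheme_entropy_common :
    entropy ((polyScheme K M x e noise).law.map (polyScheme K M x e noise).common) =
      ENNReal.ofReal ((M : ℝ) * Real.log (Fintype.card G)) + entropy noise := by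
  rw [Protocol.law_map_common]
  refine (entropy_indepPair _ _).trans ?_
  rw [entropy_uniformOfFintype]
  simp

theorem le_polyScheme_rate (hM : M < N) (k : Fin K) :
    ENNReal.ofReal (1 - (M : ℝ) / N) ≤ (polyScheme K M x e noise).rate k := by
  have hMN : (M : ℝ) < N := by exact_mod_cast hM
  have hN0 : (0 : ℝ) < N := lt_of_le_of_lt (Nat.cast_nonneg _) hMN
  have hlog : 0 < Real.log (Fintype.card G) :=
    Real.log_pos (by exact_mod_cast Fintype.one_lt_card)
  have hpos : 0 < ((N : ℝ) - M) * Real.log (Fintype.card G) := mul_pos (by linarith) hlog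
  rw [Protocol.rate, polyScheme_fileEntropy hM.le, ENNReal.le_div_iff_mul_le
    (Or.inr (ENNReal.ofReal_pos.2 hpos).ne') (Or.inr ENNReal.ofReal_ne_top)]
  have h1 : ∑ n, entropy ((polyScheme K M x e noise).law.map
      ((polyScheme K M x e noise).A k n)) ≤
      ENNReal.ofReal (N * Real.log (Fintype.card G)) := by
    -- Each answer is a single symbol of `G`.
    refine (Finset.sum_le_sum fun n _ => entropy_le_log_card (α := G) _).trans (le_of_eq ?_)
    rw [Finset.sum_const, Finset.card_univ, Fintype.card_fin, nsmul_eq_mul,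
      ENNReal.ofReal_mul (Nat.cast_nonneg _), ENNReal.ofReal_natCast]
  refine (mul_le_mul_right h1 _).trans (le_of_eq ?_)
  rw [← ENNReal.ofReal_mul (by rw [sub_nonneg, div_le_one hN0]; exact hMN.le)]
  congr 1
  field_simp

theorem polyScheme_secrecyRate (hM : M < N) {ρ : ℝ≥0} (hρ : (M : ℝ) / ((N : ℝ) - M) ≤ ρ)
    (hnoise : entropy noise =
      ENNReal.ofReal ((ρ * (N - M) - M) * Real.log (Fintype.card G))) (k : Fin K) :
    (polyScheme K M x e noise).secrecyRate k = ρ := by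
  have hMN : (M : ℝ) < N := by exact_mod_cast hM
  have hlog : 0 < Real.log (Fintype.card G) :=
    Real.log_pos (by exact_mod_cast Fintype.one_lt_card)
  have hpos : 0 < ((N : ℝ) - M) * Real.log (Fintype.card G) := mul_pos (by linarith) hlog
  rw [div_le_iff₀ (by linarith)] at hρ
  rw [Protocol.secrecyRate, polyScheme_fileEntropy hM.le, polyScheme_entropy_common, hnoise,
    ← ENNReal.ofReal_add (mul_nonneg (Nat.cast_nonneg _) hlog.le)
      (mul_nonneg (by linarith) hlog.le), ← ENNReal.ofReal_div_of_pos hpos,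
    ← ENNReal.ofReal_coe_nnreal]
  congr 1
  rw [div_eq_iff hpos.ne']
  ring

end Scheme

/-- A finite field whose order is a given power of the order of `F`. -/
theorem exists_field_card_eq_pow (F : Type) [Field F] [Fintype F] {m : ℕ} (hm : m ≠ 0) :
    ∃ (G : Type) (_ : Field G) (_ : Fintype G), Fintype.card G = Fintype.card F ^ m := by
  obtain ⟨p, _⟩ := CharP.exists F
  obtain ⟨n, hp, hn⟩ := FiniteField.card F p
  have : Fact p.Prime := ⟨hp⟩
  have hnm : (n : ℕ) * m ≠ 0 := mul_ne_zero n.pos.ne' hm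
  refine ⟨GaloisField p (n * m), inferInstance, Fintype.ofFinite _, ?_⟩
  rw [← @Nat.card_eq_fintype_card _ (Fintype.ofFinite _), GaloisField.card p _ hnm, hn, pow_mul]

theorem exists_scheme (F : Type) [Field F] [Fintype F] {N K T E : ℕ} [NeZero K]
    (hN : max T E < N) {ρ : ℝ≥0}
    (hρ : ((max T E : ℕ) : ℝ) / ((N : ℝ) - ((max T E : ℕ) : ℝ)) ≤ (ρ : ℝ)) (k : Fin K) :
    ∃ (L : ℕ) (_ : 1 ≤ L) (P : Protocol F N K L), P.IsTESPIR T E ∧ P.secrecyRate k = ρ ∧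
      ENNReal.ofReal (1 - ((max T E : ℕ) : ℝ) / (N : ℝ)) ≤ P.rate k := by
  classical
  set M := max T E
  -- Degree `N` gives enough evaluation points, since |F|^N > N; then N - M symbols of `G` are N(N -
  -- M) symbols of `F`.
  obtain ⟨G, _, _, hG⟩ := exists_field_card_eq_pow F (m := N) (by omega)
  have hNG : N ≤ Fintype.card G := by
    rw [hG]
    exact (Nat.lt_pow_self Fintype.one_lt_card).le
  obtain ⟨x⟩ : Nonempty (Fin N ↪ G) :=
    Function.Embedding.nonempty_of_card_le (by simpa using hNG)
  obtain ⟨e⟩ : Nonempty (File F (N * (N - M)) ≃ (Fin (N - M) → G)) :=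
    ⟨Fintype.equivOfCardEq (by simp [hG, pow_mul])⟩
  have hMN : (M : ℝ) < N := by exact_mod_cast hN
  -- The entropy that `S` needs beyond its `M` mask symbols; the threshold on `ρ` makes it
  -- nonnegative.
  have h0 : 0 ≤ (ρ * (N - M) - M) * Real.log (Fintype.card G) := by
    have := (div_le_iff₀ (by linarith)).1 hρ
    exact mul_nonneg (by linarith) (Real.log_natCast_nonneg _)
  obtain ⟨n, noise, hnoise⟩ := exists_entropy_eq h0
  refine ⟨N * (N - M), Nat.mul_pos (by omega) (by omega), polyScheme K M x e noise,
    polyScheme_isTESPIR hN.le (le_max_left _ _) (le_max_right _ _),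
    polyScheme_secrecyRate hN hρ hnoise k, le_polyScheme_rate hN k⟩

end SPIR

end

theorem theorem2 (F : Type) [Field F] [Fintype F] (N K T E : ℕ) [NeZero K]
    (hK : 2 ≤ K) (hN : max T E < N) (ρ : ℝ≥0) (k : Fin K) :
    SPIR.capacityTESPIR F N K T E ρ k =
      if ((max T E : ℕ) : ℝ) / ((N : ℝ) - ((max T E : ℕ) : ℝ)) ≤ (ρ : ℝ) then
        ENNReal.ofReal (1 - ((max T E : ℕ) : ℝ) / (N : ℝ))
      else 0 := by
  unfold SPIR.capacityTESPIR
  split_ifs with hρ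
  · refine le_antisymm ?_ ?_
    · exact iSup_le fun L => iSup_le fun hL => iSup_le fun P => iSup_le fun hP =>
        iSup_le fun hS => hP.rate_le hK hN hL hS
    · obtain ⟨L, hL, P, hP, hS, hR⟩ := SPIR.exists_scheme F (K := K) hN hρ k
      exact hR.trans (le_iSup_of_le L (le_iSup_of_le hL (le_iSup_of_le P
        (le_iSup_of_le hP (le_iSup_of_le hS le_rfl)))))
  · refine le_antisymm ?_ zero_le
    exact iSup_le fun L => iSup_le fun hL => iSup_le fun P => iSup_le fun hP =>
      iSup_le fun hS => absurd (hP.secrecyRate_ge hK hN hL hS) hρ
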